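/- Let $u_3=\phi(x,u,u_1,u_2)$ be a third-order ODE with $\phi$ smooth on an open set $J$ of the space of variables $(x,u,u_1,u_2)$, let $\mathbf A_{(x,u)}=\partial_x+u_1\partial_u+u_2\partial_{u_1}+\phi\,\partial_{u_2}$ be its associated vector field, and let $\mathbf v_1,\mathbf v_2,\mathbf v_3$ be smooth vector fields on an open set $M$ of the $(x,u)$-plane, with $J$ lying over $M$, that are Lie point symmetries of the equation, i.e. $[\mathbf v_i^{(2)},\mathbf A_{(x,u)}]=-\mathbf A_{(x,u)}(\mathbf v_i(x))\,\mathbf A_{(x,u)}$ on $J$, where $\mathbf v_i^{(k)}$ is the $k$-th prolongation of $\mathbf v_i$, and that satisfy $$[\mathbf v_1,\mathbf v_3]=\mathbf v_1,\qquad [\mathbf v_1,\mathbf v_2]=2\mathbf v_3,\qquad [\mathbf v_3,\mathbf v_2]=\mathbf v_2 .$$ Assume that $\mathbf A_{(x,u)},\mathbf v_1^{(2)},\mathbf v_2^{(2)},\mathbf v_3^{(2)}$ are linearly independent at every point of $J$. Let $\varphi(x,u)=(y(x,u),\alpha(x,u))$ be a smooth change of variables on $M$ in which $\mathbf v_3$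 becomes $\partial_\alpha$, with $D_xy\ne0$ on $J$ ($D_x$ denotes the total derivative). Put $w=\alpha_1=d\alpha/dy$ and $w_i=\alpha_{i+1}=d^{i+1}\alpha/dy^{i+1}$, let $w_2=\widetilde\phi(y,w,w_1)$ be the equation, reduced by $\mathbf v_3$, that the third-order ODE becomes in these variables, with $\widetilde\phi$ smooth on an open set $\Omega$ that contains all the points $(y,w,w_1)$ coming from $J$, and let $\mathbf A_{(y,w)}=\partial_y+w_1\partial_w+\widetilde\phi\,\partial_{w_1}$ and $\mathbf A_{(y,\alpha)}=\partial_y+\alpha_1\partial_\alpha+\alpha_2\partial_{\alpha_1}+\widetilde\phi(y,\alpha_1,\alpha_2)\,\partial_{\alpha_2}$. Let $\varsigma_1,\varsigma_2$ be smooth nowhere vanishing functions on $M$ with $\mathbf v_3(\varsigma_1)=\varsigma_1$ and $\mathbf v_3(\varsigma_2)=-\varsigma_2$. For $i=1,2$ let the smooth vector field $\overline{\mathbf v}_i$ in the variables $(y,w)$ be the projection of $\varsigma_i\mathbf v_i^{(1)}$ under $(x,u,u_1)\mapsto(y,w)$, and let $\lambda_i=\lambda_i(y,w,w_1)$ be the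 smooth function $-\mathbf A_{(y,\alpha)}(\varsigma_i)/\varsigma_i$. Denote by $$\mathbf Y_i=\xi_i\partial_y+\eta_i\partial_w+\bigl((D_y+\lambda_i)(\eta_i)-(D_y+\lambda_i)(\xi_i)\,w_1\bigr)\partial_{w_1}$$ the $\lambda_i$-prolongation of $\overline{\mathbf v}_i=\xi_i\partial_y+\eta_i\partial_w$. Here a first integral of a vector field is a smooth function that it annihilates and that is not constant on any nonempty open subset of its domain. For $i=1,2$ let $I_i=I_i(y,w,w_1)$ be a first integral of $\mathbf A_{(y,w)}$ on $\Omega$ associated to $(\overline{\mathbf v}_i,\lambda_i)$, i.e. one with also $\mathbf Y_i(I_i)=0$. Then, on $J$, the functions $I_i\bigl(y(x,u),w(x,u,u_1),w_1(x,u,u_1,u_2)\bigr)$, $i=1,2$, are two functionally independent first integrals of $\mathbf A_{(x,u)}$ such that $$\mathbf v_1^{(2)}(I_1)=\mathbf v_3^{(2)}(I_1)=0,\qquad \mathbf v_2^{(2)}(I_2)=\mathbf v_3^{(2)}(I_2)=0 .$$ Functional independence means that on no nonempty open subset $U$ of $J$ are the two functions functionally dependent, where functional dependence on $U$ means that near every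 point of $U$ they satisfy a relation $R(I_1,I_2)=0$ with $R:\mathbb R^2\to\mathbb R$ smooth and not identically zero on any nonempty open set. Moreover, the differentials of the two functions are linearly independent at each point of $J$ at whose image in $\Omega$ neither $dI_1$ nor $dI_2$ vanishes. -/

import Mathlib

open scoped ContDiff

noncomputable section

/-! Jet coordinates: a point of `Fin 2 → ℝ` is `(x, u)`, a point of `Fin 3 → ℝ` is `(x, u, u₁)`
and a point of `Fin 4 → ℝ` is `(x, u, u₁, u₂)`. The same spaces serve for the coordinates
`(y, α)`, `(y, α, α₁)`, `(y, α, α₁, α₂)` and, for the reduced equation, `(y, w)`, `(y, w, w₁)`. -/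

namespace SLTwoReduction

/-- Projection `(x, u, u₁) ↦ (x, u)`. -/
def base3 (q : Fin 3 → ℝ) : Fin 2 → ℝ := ![q 0, q 1]

/-- Projection `(x, u, u₁, u₂) ↦ (x, u, u₁)`. -/
def jet1 (p : Fin 4 → ℝ) : Fin 3 → ℝ := ![p 0, p 1, p 2]

/-- Projection `(x, u, u₁, u₂) ↦ (x, u)`. -/
def base4 (p : Fin 4 → ℝ) : Fin 2 → ℝ := ![p 0, p 1]

/-- The derivative `V(f)` of the function `f` along the vector field `V`. -/
def along {n : ℕ} (V : (Fin n → ℝ) → (Fin n → ℝ)) (f : (Fin n → ℝ) → ℝ) (p : Fin n → ℝ) : ℝ :=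
  fderiv ℝ f p (V p)

/-- The total derivative `D_x f = f_x + u₁ f_u` of a function `f(x, u)`. -/
def totalDeriv0 (f : (Fin 2 → ℝ) → ℝ) (q : Fin 3 → ℝ) : ℝ :=
  fderiv ℝ f (base3 q) ![1, q 2]

/-- The total derivative `D_x f = f_x + u₁ f_u + u₂ f_{u₁}` of a function `f(x, u, u₁)`. -/
def totalDeriv1 (f : (Fin 3 → ℝ) → ℝ) (p : Fin 4 → ℝ) : ℝ :=
  fderiv ℝ f (jet1 p) ![1, p 2, p 3]

/-- The vector field `∂_x + u₁ ∂_u + u₂ ∂_{u₁} + Φ(x, u, u₁, u₂) ∂_{u₂}` associated to the equation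
`u₃ = Φ(x, u, u₁, u₂)`. -/
def odeField3 (Φ : (Fin 4 → ℝ) → ℝ) (p : Fin 4 → ℝ) : Fin 4 → ℝ :=
  ![1, p 2, p 3, Φ p]

/-- The vector field `∂_y + w₁ ∂_w + Ψ(y, w, w₁) ∂_{w₁}` associated to the equation
`w₂ = Ψ(y, w, w₁)`. -/
def odeField2 (Ψ : (Fin 3 → ℝ) → ℝ) (q : Fin 3 → ℝ) : Fin 3 → ℝ :=
  ![1, q 2, Ψ q]

/-- The coefficient `η¹ = D_x η - u₁ D_x ξ` of `∂_{u₁}` in the prolongations of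
`v = ξ ∂_x + η ∂_u`. -/
def prolongCoeff1 (v : (Fin 2 → ℝ) → (Fin 2 → ℝ)) (q : Fin 3 → ℝ) : ℝ :=
  totalDeriv0 (fun m => v m 1) q - q 2 * totalDeriv0 (fun m => v m 0) q

/-- The coefficient `η² = D_x η¹ - u₂ D_x ξ` of `∂_{u₂}` in the second prolongation of
`v = ξ ∂_x + η ∂_u`. -/
def prolongCoeff2 (v : (Fin 2 → ℝ) → (Fin 2 → ℝ)) (p : Fin 4 → ℝ) : ℝ :=
  totalDeriv1 (prolongCoeff1 v) p - p 3 * totalDeriv0 (fun m => v m 0) (jet1 p)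

/-- The first prolongation `v^{(1)}` of a vector field `v` on the plane. -/
def prolong1 (v : (Fin 2 → ℝ) → (Fin 2 → ℝ)) (q : Fin 3 → ℝ) : Fin 3 → ℝ :=
  ![v (base3 q) 0, v (base3 q) 1, prolongCoeff1 v q]

/-- The second prolongation `v^{(2)}` of a vector field `v` on the plane. -/
def prolong2 (v : (Fin 2 → ℝ) → (Fin 2 → ℝ)) (p : Fin 4 → ℝ) : Fin 4 → ℝ :=
  ![v (base4 p) 0, v (base4 p) 1, prolongCoeff1 v (jet1 p), prolongCoeff2 v p]

/-- `v = ξ ∂_x + η ∂_u` is a Lie point symmetry on `J` of the equation `u₃ = Φ(x, u, u₁, u₂)`: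
`[v^{(2)}, A] = -A(ξ) A`, where `A` is the vector field associated to the equation. -/
def IsLiePointSymmetryOn (Φ : (Fin 4 → ℝ) → ℝ) (v : (Fin 2 → ℝ) → (Fin 2 → ℝ))
    (J : Set (Fin 4 → ℝ)) : Prop :=
  ∀ p ∈ J, VectorField.lieBracket ℝ (prolong2 v) (odeField3 Φ) p =
    -(along (odeField3 Φ) (fun p' => v (base4 p') 0) p) • odeField3 Φ p

/-- The `λ`-prolongation `v^{[λ,(1)]}` of `v = ξ ∂_y + η ∂_w`, whose `∂_{w₁}`-coefficient is
`(D_y + λ)(η) - (D_y + λ)(ξ) w₁`. -/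
def lambdaProlong (v : (Fin 2 → ℝ) → (Fin 2 → ℝ)) (lam : (Fin 3 → ℝ) → ℝ) (q : Fin 3 → ℝ) :
    Fin 3 → ℝ :=
  ![v (base3 q) 0, v (base3 q) 1,
    (totalDeriv0 (fun m => v m 1) q + lam q * v (base3 q) 1) -
      (totalDeriv0 (fun m => v m 0) q + lam q * v (base3 q) 0) * q 2]

/-- `α₁ = dα/dy = D_x α / D_x y` as a function of `(x, u, u₁)`, for a change of variables
`χ(x, u) = (y, α)`. -/
def alpha1 (χ : (Fin 2 → ℝ) → (Fin 2 → ℝ)) (q : Fin 3 → ℝ) : ℝ :=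
  totalDeriv0 (fun m => χ m 1) q / totalDeriv0 (fun m => χ m 0) q

/-- `α₂ = dα₁/dy = D_x α₁ / D_x y` as a function of `(x, u, u₁, u₂)`. -/
def alpha2 (χ : (Fin 2 → ℝ) → (Fin 2 → ℝ)) (p : Fin 4 → ℝ) : ℝ :=
  totalDeriv1 (alpha1 χ) p / totalDeriv0 (fun m => χ m 0) (jet1 p)

/-- The prolonged change of variables `χ^{(1)} : (x, u, u₁) ↦ (y, α, α₁)`. -/
def prolongMap1 (χ : (Fin 2 → ℝ) → (Fin 2 → ℝ)) (q : Fin 3 → ℝ) : Fin 3 → ℝ :=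
  ![χ (base3 q) 0, χ (base3 q) 1, alpha1 χ q]

/-- The prolonged change of variables `χ^{(2)} : (x, u, u₁, u₂) ↦ (y, α, α₁, α₂)`. -/
def prolongMap2 (χ : (Fin 2 → ℝ) → (Fin 2 → ℝ)) (p : Fin 4 → ℝ) : Fin 4 → ℝ :=
  ![χ (base4 p) 0, χ (base4 p) 1, alpha1 χ (jet1 p), alpha2 χ p]

/-- The projection `(y, α, w) ↦ (y, w)`, where `w = α₁`. -/
def proj1 (q : Fin 3 → ℝ) : Fin 2 → ℝ := ![q 0, q 2]

/-- The projection `(y, α, w, w₁) ↦ (y, w, w₁)`, where `w = α₁` and `w₁ = α₂`. -/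
def proj2 (p : Fin 4 → ℝ) : Fin 3 → ℝ := ![p 0, p 2, p 3]

/-- The map `(x, u, u₁) ↦ (y(x, u), w(x, u, u₁))`. -/
def reduce1 (χ : (Fin 2 → ℝ) → (Fin 2 → ℝ)) (q : Fin 3 → ℝ) : Fin 2 → ℝ :=
  proj1 (prolongMap1 χ q)

/-- The map `(x, u, u₁, u₂) ↦ (y(x, u), w(x, u, u₁), w₁(x, u, u₁, u₂))`. -/
def reduce2 (χ : (Fin 2 → ℝ) → (Fin 2 → ℝ)) (p : Fin 4 → ℝ) : Fin 3 → ℝ :=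
  proj2 (prolongMap2 χ p)

/-- Over `J`, the equation `u₃ = Φ(x, u, u₁, u₂)` becomes the reduced equation `w₂ = Ψ(y, w, w₁)`:
the value that `u₃ = Φ` gives to `w₂ = D_x w₁ / D_x y` is `Ψ(y, w, w₁)`. -/
def IsReducedEquationOn (Φ : (Fin 4 → ℝ) → ℝ) (χ : (Fin 2 → ℝ) → (Fin 2 → ℝ))
    (Ψ : (Fin 3 → ℝ) → ℝ) (J : Set (Fin 4 → ℝ)) : Prop :=
  ∀ p ∈ J, along (odeField3 Φ) (alpha2 χ) p / totalDeriv0 (fun m => χ m 0) (jet1 p) =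
    Ψ (reduce2 χ p)

/-- Over `J`, the vector field `vbar` in the variables `(y, w)` is the projection of the vector
field `ς v^{(1)}`. -/
def IsProjectionOn (χ : (Fin 2 → ℝ) → (Fin 2 → ℝ)) (ς : (Fin 2 → ℝ) → ℝ)
    (v vbar : (Fin 2 → ℝ) → (Fin 2 → ℝ)) (J : Set (Fin 4 → ℝ)) : Prop :=
  ∀ p ∈ J, fderiv ℝ (reduce1 χ) (jet1 p) (ς (base4 p) • prolong1 v (jet1 p)) =
    vbar (reduce1 χ (jet1 p))

/-- Over `J`, the function `lam` in the variables `(y, w, w₁)` is `-A_{(y,α)}(ς) / ς`, where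
`A_{(y,α)}` is the vector field associated to `α₃ = Ψ(y, α₁, α₂)` and `ς` is written in the
variables `(y, α)`. -/
def IsInheritedLambdaOn (χ : OpenPartialHomeomorph (Fin 2 → ℝ) (Fin 2 → ℝ))
    (Ψ : (Fin 3 → ℝ) → ℝ) (ς : (Fin 2 → ℝ) → ℝ) (lam : (Fin 3 → ℝ) → ℝ)
    (J : Set (Fin 4 → ℝ)) : Prop :=
  ∀ p ∈ J, lam (reduce2 χ p) =
    -(along (odeField3 fun P => Ψ (proj2 P)) (fun P => ς (χ.symm (base4 P)))
        (prolongMap2 χ p)) / ς (base4 p)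

/-- `I` is a (smooth, nowhere locally constant) first integral on `D` of the vector field `A`. -/
structure IsFirstIntegralOn {n : ℕ} (A : (Fin n → ℝ) → (Fin n → ℝ)) (I : (Fin n → ℝ) → ℝ)
    (D : Set (Fin n → ℝ)) : Prop where
  smooth : ContDiffOn ℝ ∞ I D
  nonconstant : ∀ U ⊆ D, IsOpen U → U.Nonempty → ¬ ∃ c : ℝ, ∀ p ∈ U, I p = c
  invariant : ∀ p ∈ D, along A I p = 0

/-- `I` is a first integral on `Ω` of the vector field associated to `w₂ = Ψ(y, w, w₁)`, associated
to the pair `(vbar, lam)`: it is also annihilated by the `λ`-prolongation of `vbar`. -/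
def IsAssociatedFirstIntegralOn (Ψ : (Fin 3 → ℝ) → ℝ) (vbar : (Fin 2 → ℝ) → (Fin 2 → ℝ))
    (lam I : (Fin 3 → ℝ) → ℝ) (Ω : Set (Fin 3 → ℝ)) : Prop :=
  IsFirstIntegralOn (odeField2 Ψ) I Ω ∧ ∀ q ∈ Ω, along (lambdaProlong vbar lam) I q = 0

/-- `f` and `g` are functionally dependent on `U`: near every point of `U` they satisfy a relation
`R(f, g) = 0`, with `R` smooth and not identically zero on any nonempty open set. -/
def FunctionallyDependentOn {n : ℕ} (f g : (Fin n → ℝ) → ℝ) (U : Set (Fin n → ℝ)) : Prop :=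
  ∀ p ∈ U, ∃ V : Set (Fin n → ℝ), IsOpen V ∧ p ∈ V ∧ ∃ R : (Fin 2 → ℝ) → ℝ, ContDiff ℝ ∞ R ∧
    (∀ W : Set (Fin 2 → ℝ), IsOpen W → W.Nonempty → ∃ z ∈ W, R z ≠ 0) ∧
    ∀ p' ∈ V ∩ U, R ![f p', g p'] = 0

/-- `f` and `g` are functionally independent on `D`: they are not functionally dependent on any
nonempty open subset of `D`. -/
def FunctionallyIndependentOn {n : ℕ} (f g : (Fin n → ℝ) → ℝ) (D : Set (Fin n → ℝ)) : Prop :=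
  ∀ U ⊆ D, IsOpen U → U.Nonempty → ¬ FunctionallyDependentOn f g U

end SLTwoReduction

end

open Filter
open scoped ContDiff Topology

namespace SLTwoReduction

/-! Let π = (y, w, w₁) be `reduce2 χ`. Everything follows from where dπ sends four vector fields. It
carries A to D_x y times the field of the reduced equation (`fderiv_reduce2_odeField3`), kills
v₃^{(2)}, since v₃ is ∂_α and π does not see α (`fderiv_reduce2_prolong2_canonical`), and carries ςᵢ
vᵢ^{(2)} to the λᵢ-prolongation Yᵢ (`fderiv_reduce2_smul_prolong2`). Because ςᵢ never vanishes, Iᵢ ∘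
π is annihilated by A, v₃^{(2)} and vᵢ^{(2)}.

The third fact rests on the commutation v^{(k+1)} D_x = D_x v^{(k)} - D_x(ξ) D_x. Differentiating
the projection identities for ςᵢ vᵢ^{(1)} along D_x produces the extra term D_x ςᵢ, which is exactly
what λᵢ = -(D_x ςᵢ / D_x y) / ςᵢ accounts for.

The map π is a submersion, so the pullbacks are not locally constant and their differentials vanish
only where dIᵢ does. Where both differentials are nonzero, the frame A, v₁^{(2)}, v₂^{(2)}, v₃^{(2)}
separates them: the first can be nonzero only on v₂^{(2)}, the second only on v₁^{(2)}. Every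
nonempty open set contains such a point. There the pair of functions is a submersion to the plane,
so its values fill an open set and no admissible relation R can hold. -/

/-! ### Commutation with a total derivative, abstractly -/

theorem fderiv_fderiv_apply_apply {E F : Type*} [NormedAddCommGroup E] [NormedSpace ℝ E]
    [NormedAddCommGroup F] [NormedSpace ℝ F] {f : E → ℝ} {b T : F → E} {b' T' : F →L[ℝ] E} {p : F}
    (hf : ContDiffAt ℝ ∞ f (b p)) (hb : HasFDerivAt b b' p) (hT : HasFDerivAt T T' p) (V : F) :
    fderiv ℝ (fun z => fderiv ℝ f (b z) (T z)) p V =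
      fderiv ℝ (fderiv ℝ f) (b p) (b' V) (T p) + fderiv ℝ f (b p) (T' V) := by
  have h2 : DifferentiableAt ℝ (fderiv ℝ f) (b p) :=
    (hf.fderiv_right (m := 1) (by norm_cast)).differentiableAt (by norm_num)
  have h3 := (h2.hasFDerivAt.comp p hb).clm_apply hT
  have h4 := h3.fderiv
  simp only [Function.comp_def] at h4
  rw [h4]
  simp [add_comm]

/-- The commutation of a prolonged vector field with the total derivative, in abstract form:
`V(D f) = D(v f) - c D f`, where `D f = df(T)` along the projection `b`. -/
theorem fderiv_total_apply {E F : Type*} [NormedAddCommGroup E] [NormedSpace ℝ E]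
    [NormedAddCommGroup F] [NormedSpace ℝ F] {f : E → ℝ} {b T : F → E} {b' T' : F →L[ℝ] E}
    {p V : F} {v : E → E} {c : ℝ}
    (hf : ContDiffAt ℝ ∞ f (b p)) (hv : DifferentiableAt ℝ v (b p))
    (hb : HasFDerivAt b b' p) (hT : HasFDerivAt T T' p) (hbV : b' V = v (b p))
    (hTV : T' V = fderiv ℝ v (b p) (T p) - c • T p) :
    fderiv ℝ (fun z => fderiv ℝ f (b z) (T z)) p V =
      fderiv ℝ (fun m => fderiv ℝ f m (v m)) (b p) (T p) - c * fderiv ℝ f (b p) (T p) := by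
  -- The second-order terms D²f(v, T) and D²f(T, v) of the two sides agree by symmetry; `hTV`
  -- matches the first-order ones.
  have hsym : IsSymmSndFDerivAt ℝ f (b p) :=
    hf.isSymmSndFDerivAt (by simpa using WithTop.coe_le_coe.2 (le_top : (2 : ℕ∞) ≤ ⊤))
  have h1 := fderiv_fderiv_apply_apply (p := b p) (b := id) hf (hasFDerivAt_id _) hv.hasFDerivAt (T p)
  simp only [id] at h1
  rw [fderiv_fderiv_apply_apply hf hb hT, h1, hbV, hTV, hsym.eq (v (b p)) (T p)]
  simp
  ring

/-! ### Jet projections and smoothness of total derivatives -/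

/-- `base3` as a continuous linear map. -/
def base3L : (Fin 3 → ℝ) →L[ℝ] (Fin 2 → ℝ) :=
  ContinuousLinearMap.pi ![.proj 0, .proj 1]

/-- `jet1` as a continuous linear map. -/
def jet1L : (Fin 4 → ℝ) →L[ℝ] (Fin 3 → ℝ) :=
  ContinuousLinearMap.pi ![.proj 0, .proj 1, .proj 2]

/-- The linear part of `(x, u, u₁) ↦ (1, u₁)`. -/
def shift3L : (Fin 3 → ℝ) →L[ℝ] (Fin 2 → ℝ) :=
  ContinuousLinearMap.pi ![0, .proj 2]

/-- The linear part of `(x, u, u₁, u₂) ↦ (1, u₁, u₂)`. -/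
def shift4L : (Fin 4 → ℝ) →L[ℝ] (Fin 3 → ℝ) :=
  ContinuousLinearMap.pi ![0, .proj 2, .proj 3]

theorem base3L_apply (q : Fin 3 → ℝ) : base3L q = base3 q := by
  ext i; fin_cases i <;> rfl

theorem jet1L_apply (p : Fin 4 → ℝ) : jet1L p = jet1 p := by
  ext i; fin_cases i <;> rfl

theorem shift3L_apply (q : Fin 3 → ℝ) : shift3L q = ![0, q 2] := by
  ext i; fin_cases i <;> rfl

theorem shift4L_apply (p : Fin 4 → ℝ) : shift4L p = ![0, p 2, p 3] := by
  ext i; fin_cases i <;> rfl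

theorem base3_jet1 (p : Fin 4 → ℝ) : base3 (jet1 p) = base4 p := rfl

theorem hasFDerivAt_base3 (q : Fin 3 → ℝ) : HasFDerivAt base3 base3L q := by
  have h : (base3 : (Fin 3 → ℝ) → _) = base3L := funext fun q => (base3L_apply q).symm
  rw [h]; exact base3L.hasFDerivAt

theorem hasFDerivAt_jet1 (p : Fin 4 → ℝ) : HasFDerivAt jet1 jet1L p := by
  have h : (jet1 : (Fin 4 → ℝ) → _) = jet1L := funext fun q => (jet1L_apply q).symm
  rw [h]; exact jet1L.hasFDerivAt

theorem contDiff_base3 : ContDiff ℝ ∞ base3 := by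
  have h : (base3 : (Fin 3 → ℝ) → _) = base3L := funext fun q => (base3L_apply q).symm
  rw [h]; exact base3L.contDiff

theorem contDiff_jet1 : ContDiff ℝ ∞ jet1 := by
  have h : (jet1 : (Fin 4 → ℝ) → _) = jet1L := funext fun q => (jet1L_apply q).symm
  rw [h]; exact jet1L.contDiff

theorem isOpenMap_jet1 : IsOpenMap jet1 := by
  have h : (jet1 : (Fin 4 → ℝ) → _) = jet1L := funext fun q => (jet1L_apply q).symm
  rw [h]
  refine jet1L.isOpenMap fun q => ⟨![q 0, q 1, q 2, 0], ?_⟩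
  ext i; fin_cases i <;> rfl

theorem vec2_eq (q : Fin 3 → ℝ) : (![1, q 2] : Fin 2 → ℝ) = ![1, 0] + shift3L q := by
  ext i; fin_cases i <;> simp [shift3L_apply]

theorem vec3_eq (p : Fin 4 → ℝ) : (![1, p 2, p 3] : Fin 3 → ℝ) = ![1, 0, 0] + shift4L p := by
  ext i; fin_cases i <;> simp [shift4L_apply]

theorem hasFDerivAt_vec2 (q : Fin 3 → ℝ) :
    HasFDerivAt (fun q : Fin 3 → ℝ => (![1, q 2] : Fin 2 → ℝ)) shift3L q := by
  simp_rw [vec2_eq]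
  exact shift3L.hasFDerivAt.const_add _

theorem hasFDerivAt_vec3 (p : Fin 4 → ℝ) :
    HasFDerivAt (fun p : Fin 4 → ℝ => (![1, p 2, p 3] : Fin 3 → ℝ)) shift4L p := by
  simp_rw [vec3_eq]
  exact shift4L.hasFDerivAt.const_add _

theorem contDiff_vec2 : ContDiff ℝ ∞ (fun q : Fin 3 → ℝ => (![1, q 2] : Fin 2 → ℝ)) := by
  simp_rw [vec2_eq]
  exact contDiff_const.add shift3L.contDiff

theorem contDiff_vec3 : ContDiff ℝ ∞ (fun p : Fin 4 → ℝ => (![1, p 2, p 3] : Fin 3 → ℝ)) := by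
  simp_rw [vec3_eq]
  exact contDiff_const.add shift4L.contDiff

theorem contDiffAt_totalDeriv0 {f : (Fin 2 → ℝ) → ℝ} {q : Fin 3 → ℝ}
    (hf : ContDiffAt ℝ ∞ f (base3 q)) : ContDiffAt ℝ ∞ (totalDeriv0 f) q :=
  ((hf.fderiv_right (m := ∞) (by norm_cast)).comp q contDiff_base3.contDiffAt).clm_apply
    contDiff_vec2.contDiffAt

theorem contDiffAt_totalDeriv1 {f : (Fin 3 → ℝ) → ℝ} {p : Fin 4 → ℝ}
    (hf : ContDiffAt ℝ ∞ f (jet1 p)) : ContDiffAt ℝ ∞ (totalDeriv1 f) p :=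
  ((hf.fderiv_right (m := ∞) (by norm_cast)).comp p contDiff_jet1.contDiffAt).clm_apply
    contDiff_vec3.contDiffAt

theorem totalDeriv1_comp_base3 {f : (Fin 2 → ℝ) → ℝ} {p : Fin 4 → ℝ}
    (hf : DifferentiableAt ℝ f (base4 p)) :
    totalDeriv1 (fun q => f (base3 q)) p = totalDeriv0 f (jet1 p) := by
  have h := (hf.hasFDerivAt.comp (jet1 p) (hasFDerivAt_base3 (jet1 p))).fderiv
  simp only [Function.comp_def] at h
  rw [totalDeriv1, h, totalDeriv0]
  simp only [ContinuousLinearMap.comp_apply, base3L_apply]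
  rfl

theorem fderiv_apply_coord {m n : ℕ} {f : (Fin m → ℝ) → (Fin n → ℝ)} {p : Fin m → ℝ}
    (hf : DifferentiableAt ℝ f p) (V : Fin m → ℝ) (i : Fin n) :
    fderiv ℝ f p V i = fderiv ℝ (fun z => f z i) p V := by
  have h := (hasFDerivAt_pi'.1 hf.hasFDerivAt i).fderiv
  rw [h]; rfl

theorem contDiffAt_prolongCoeff1 {v : (Fin 2 → ℝ) → (Fin 2 → ℝ)} {q : Fin 3 → ℝ}
    (hv : ContDiffAt ℝ ∞ v (base3 q)) : ContDiffAt ℝ ∞ (prolongCoeff1 v) q := by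
  have h := contDiffAt_pi.1 hv
  exact (contDiffAt_totalDeriv0 (h 1)).sub
    ((contDiff_apply ℝ ℝ (2 : Fin 3)).contDiffAt.mul (contDiffAt_totalDeriv0 (h 0)))

theorem contDiffAt_prolong1 {v : (Fin 2 → ℝ) → (Fin 2 → ℝ)} {q : Fin 3 → ℝ}
    (hv : ContDiffAt ℝ ∞ v (base3 q)) : ContDiffAt ℝ ∞ (prolong1 v) q := by
  have h : ∀ i, ContDiffAt ℝ ∞ (fun q => v (base3 q) i) q := fun i =>
    (contDiffAt_pi.1 hv i).comp q contDiff_base3.contDiffAt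
  refine contDiffAt_pi.2 fun i => ?_
  fin_cases i
  · exact h 0
  · exact h 1
  · exact contDiffAt_prolongCoeff1 hv

/-! ### Prolongations and total derivatives -/

/-- `v^{(1)}(D_x f) = D_x(v(f)) - D_x(ξ) D_x f`. -/
theorem along_prolong1_totalDeriv0 {v : (Fin 2 → ℝ) → (Fin 2 → ℝ)} {f : (Fin 2 → ℝ) → ℝ}
    {q : Fin 3 → ℝ} (hv : ContDiffAt ℝ ∞ v (base3 q)) (hf : ContDiffAt ℝ ∞ f (base3 q)) :
    along (prolong1 v) (totalDeriv0 f) q =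
      totalDeriv0 (along v f) q - totalDeriv0 (fun m => v m 0) q * totalDeriv0 f q := by
  have hv' := hv.differentiableAt (by simp)
  -- The condition on `T' V` is the prolongation formula itself: (0, η¹) = (D_x ξ, D_x η) - D_x ξ ·
  -- (1, u₁).
  refine fderiv_total_apply (T := fun q : Fin 3 → ℝ => ![1, q 2]) hf hv' (hasFDerivAt_base3 q)
    (hasFDerivAt_vec2 q) ?_ ?_
  · rw [base3L_apply]
    ext i; fin_cases i <;> rfl
  · rw [shift3L_apply]
    ext i
    simp only [Pi.sub_apply, fderiv_apply_coord hv']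
    fin_cases i
    · simp [totalDeriv0]
    · simp [prolong1, prolongCoeff1, totalDeriv0, mul_comm]

/-- `v^{(2)}(D_x f) = D_x(v^{(1)}(f)) - D_x(ξ) D_x f`. -/
theorem along_prolong2_totalDeriv1 {v : (Fin 2 → ℝ) → (Fin 2 → ℝ)} {f : (Fin 3 → ℝ) → ℝ}
    {p : Fin 4 → ℝ} (hv : ContDiffAt ℝ ∞ v (base4 p)) (hf : ContDiffAt ℝ ∞ f (jet1 p)) :
    along (prolong2 v) (totalDeriv1 f) p =
      totalDeriv1 (along (prolong1 v) f) p -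
        totalDeriv0 (fun m => v m 0) (jet1 p) * totalDeriv1 f p := by
  have hv' := (contDiffAt_prolong1 (q := jet1 p) hv).differentiableAt (by simp)
  have hvi : ∀ i, DifferentiableAt ℝ (fun m => v m i) (base4 p) := fun i =>
    (contDiffAt_pi.1 hv i).differentiableAt (by simp)
  refine fderiv_total_apply (T := fun p : Fin 4 → ℝ => ![1, p 2, p 3]) hf hv' (hasFDerivAt_jet1 p)
    (hasFDerivAt_vec3 p) ?_ ?_
  · rw [jet1L_apply]
    ext i; fin_cases i <;> rfl
  · rw [shift4L_apply]
    have h0 := totalDeriv1_comp_base3 (hvi 0)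
    have h1 := totalDeriv1_comp_base3 (hvi 1)
    ext i
    simp only [Pi.sub_apply, fderiv_apply_coord hv']
    fin_cases i
    · simp only [totalDeriv1] at h0
      simp [prolong1, h0]
    · simp only [totalDeriv1] at h1
      simp [prolong1, prolong2, h1, prolongCoeff1, mul_comm]
      simp [jet1]
    · simp [prolong1, prolong2, prolongCoeff2, totalDeriv1, mul_comm]

/-- The quotient rule is arranged so that f / g appears on the right, as α₁ and α₂ do in the
prolongation formulas. -/
theorem along_div {n : ℕ} {V : (Fin n → ℝ) → (Fin n → ℝ)} {f g : (Fin n → ℝ) → ℝ} {p : Fin n → ℝ}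
    (hf : DifferentiableAt ℝ f p) (hg : DifferentiableAt ℝ g p) (h0 : g p ≠ 0) :
    along V (fun z => f z / g z) p = (along V f p - f p / g p * along V g p) / g p := by
  have h := (hf.hasFDerivAt.mul ((hasDerivAt_inv h0).comp_hasFDerivAt p hg.hasFDerivAt)).fderiv
  have e : (fun z => f z / g z) = f * (Inv.inv ∘ g) := by
    ext z; simp [div_eq_mul_inv]
  rw [along, e, h]
  simp [along]
  field_simp
  ring

/-! ### The prolonged change of variables: smoothness and chain rules -/

theorem contDiffAt_alpha1 {χ : (Fin 2 → ℝ) → (Fin 2 → ℝ)} {q : Fin 3 → ℝ}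
    (hχ : ContDiffAt ℝ ∞ χ (base3 q)) (h0 : totalDeriv0 (fun m => χ m 0) q ≠ 0) :
    ContDiffAt ℝ ∞ (alpha1 χ) q :=
  (contDiffAt_totalDeriv0 (contDiffAt_pi.1 hχ 1)).div
    (contDiffAt_totalDeriv0 (contDiffAt_pi.1 hχ 0)) h0

theorem contDiffAt_alpha2 {χ : (Fin 2 → ℝ) → (Fin 2 → ℝ)} {p : Fin 4 → ℝ}
    (hχ : ContDiffAt ℝ ∞ χ (base4 p)) (h0 : totalDeriv0 (fun m => χ m 0) (jet1 p) ≠ 0) :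
    ContDiffAt ℝ ∞ (alpha2 χ) p :=
  (contDiffAt_totalDeriv1 (contDiffAt_alpha1 (q := jet1 p) hχ h0)).div
    ((contDiffAt_totalDeriv0 (q := jet1 p) (contDiffAt_pi.1 hχ 0)).comp p
      contDiff_jet1.contDiffAt) h0

theorem contDiffAt_reduce1 {χ : (Fin 2 → ℝ) → (Fin 2 → ℝ)} {q : Fin 3 → ℝ}
    (hχ : ContDiffAt ℝ ∞ χ (base3 q)) (h0 : totalDeriv0 (fun m => χ m 0) q ≠ 0) :
    ContDiffAt ℝ ∞ (reduce1 χ) q := by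
  refine contDiffAt_pi.2 fun i => ?_
  fin_cases i
  · exact (contDiffAt_pi.1 hχ 0).comp q contDiff_base3.contDiffAt
  · exact contDiffAt_alpha1 hχ h0

theorem contDiff_base4 : ContDiff ℝ ∞ base4 := contDiff_base3.comp contDiff_jet1

theorem contDiffAt_reduce2 {χ : (Fin 2 → ℝ) → (Fin 2 → ℝ)} {p : Fin 4 → ℝ}
    (hχ : ContDiffAt ℝ ∞ χ (base4 p)) (h0 : totalDeriv0 (fun m => χ m 0) (jet1 p) ≠ 0) :
    ContDiffAt ℝ ∞ (reduce2 χ) p := by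
  refine contDiffAt_pi.2 fun i => ?_
  fin_cases i
  · exact (contDiffAt_pi.1 hχ 0).comp p contDiff_base4.contDiffAt
  · exact (contDiffAt_alpha1 (q := jet1 p) hχ h0).comp p contDiff_jet1.contDiffAt
  · exact contDiffAt_alpha2 hχ h0

theorem fderiv_comp_base3 {f : (Fin 2 → ℝ) → ℝ} {q : Fin 3 → ℝ}
    (hf : DifferentiableAt ℝ f (base3 q)) (V : Fin 3 → ℝ) :
    fderiv ℝ (fun q => f (base3 q)) q V = fderiv ℝ f (base3 q) (base3 V) := by
  have h := (hf.hasFDerivAt.comp q (hasFDerivAt_base3 q)).fderiv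
  simp only [Function.comp_def] at h
  rw [h, ContinuousLinearMap.comp_apply, base3L_apply]

theorem fderiv_comp_jet1 {f : (Fin 3 → ℝ) → ℝ} {p : Fin 4 → ℝ}
    (hf : DifferentiableAt ℝ f (jet1 p)) (V : Fin 4 → ℝ) :
    fderiv ℝ (fun p => f (jet1 p)) p V = fderiv ℝ f (jet1 p) (jet1 V) := by
  have h := (hf.hasFDerivAt.comp p (hasFDerivAt_jet1 p)).fderiv
  simp only [Function.comp_def] at h
  rw [h, ContinuousLinearMap.comp_apply, jet1L_apply]

theorem along_prolong1_comp_base3 {f : (Fin 2 → ℝ) → ℝ} {v : (Fin 2 → ℝ) → (Fin 2 → ℝ)}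
    {q : Fin 3 → ℝ} (hf : DifferentiableAt ℝ f (base3 q)) :
    along (prolong1 v) (fun q => f (base3 q)) q = along v f (base3 q) := by
  rw [along, fderiv_comp_base3 hf, along]
  congr 1
  ext i; fin_cases i <;> rfl

theorem along_prolong2_comp_jet1 {f : (Fin 3 → ℝ) → ℝ} {v : (Fin 2 → ℝ) → (Fin 2 → ℝ)}
    {p : Fin 4 → ℝ} (hf : DifferentiableAt ℝ f (jet1 p)) :
    along (prolong2 v) (fun p => f (jet1 p)) p = along (prolong1 v) f (jet1 p) := by
  rw [along, fderiv_comp_jet1 hf, along]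
  congr 1

/-- `v^{(1)}(α₁) = (D_x(v(α)) - α₁ D_x(v(y))) / D_x y`. -/
theorem along_prolong1_alpha1 {χ v : (Fin 2 → ℝ) → (Fin 2 → ℝ)} {q : Fin 3 → ℝ}
    (hχ : ContDiffAt ℝ ∞ χ (base3 q)) (hv : ContDiffAt ℝ ∞ v (base3 q))
    (h0 : totalDeriv0 (fun m => χ m 0) q ≠ 0) :
    along (prolong1 v) (alpha1 χ) q =
      (totalDeriv0 (along v fun m => χ m 1) q -
        alpha1 χ q * totalDeriv0 (along v fun m => χ m 0) q) / totalDeriv0 (fun m => χ m 0) q := by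
  have h := contDiffAt_pi.1 hχ
  have e := along_div (V := prolong1 v) ((contDiffAt_totalDeriv0 (h 1)).differentiableAt (by simp))
    ((contDiffAt_totalDeriv0 (h 0)).differentiableAt (by simp)) h0
  -- The D_x ξ corrections of numerator and denominator cancel in the quotient, because α₁ D_x y =
  -- D_x α.
  rw [along_prolong1_totalDeriv0 hv (h 1), along_prolong1_totalDeriv0 hv (h 0)] at e
  refine e.trans ?_
  rw [alpha1]
  field_simp
  ring

/-- `v^{(2)}(α₂) = (D_x(v^{(1)}(α₁)) - α₂ D_x(v(y))) / D_x y`. -/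
theorem along_prolong2_alpha2 {χ v : (Fin 2 → ℝ) → (Fin 2 → ℝ)} {p : Fin 4 → ℝ}
    (hχ : ContDiffAt ℝ ∞ χ (base4 p)) (hv : ContDiffAt ℝ ∞ v (base4 p))
    (h0 : totalDeriv0 (fun m => χ m 0) (jet1 p) ≠ 0) :
    along (prolong2 v) (alpha2 χ) p =
      (totalDeriv1 (along (prolong1 v) (alpha1 χ)) p -
        alpha2 χ p * totalDeriv0 (along v fun m => χ m 0) (jet1 p)) /
          totalDeriv0 (fun m => χ m 0) (jet1 p) := by
  have h := contDiffAt_pi.1 hχ 0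
  have hα := contDiffAt_alpha1 (q := jet1 p) hχ h0
  have hy := contDiffAt_totalDeriv0 (q := jet1 p) h
  have e := along_div (V := prolong2 v) ((contDiffAt_totalDeriv1 hα).differentiableAt (by simp))
    ((hy.comp p contDiff_jet1.contDiffAt).differentiableAt (by simp)) h0
  simp only [Function.comp_def] at e
  rw [along_prolong2_totalDeriv1 hv hα, along_prolong2_comp_jet1 (hy.differentiableAt (by simp)),
    along_prolong1_totalDeriv0 (q := jet1 p) hv h] at e
  refine e.trans ?_
  rw [alpha2]
  field_simp
  ring

theorem totalDeriv0_comp {f : (Fin 2 → ℝ) → ℝ} {χ : (Fin 2 → ℝ) → (Fin 2 → ℝ)} {q : Fin 3 → ℝ}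
    (hχ : DifferentiableAt ℝ χ (base3 q)) (hf : DifferentiableAt ℝ f (χ (base3 q))) :
    totalDeriv0 (fun m => f (χ m)) q = fderiv ℝ f (χ (base3 q))
      ![totalDeriv0 (fun m => χ m 0) q, totalDeriv0 (fun m => χ m 1) q] := by
  have h := (hf.hasFDerivAt.comp (base3 q) hχ.hasFDerivAt).fderiv
  simp only [Function.comp_def] at h
  rw [totalDeriv0, h, ContinuousLinearMap.comp_apply]
  congr 1
  ext i
  rw [fderiv_apply_coord hχ]
  fin_cases i <;> rfl

theorem totalDeriv1_comp {f : (Fin 2 → ℝ) → ℝ} {g : (Fin 3 → ℝ) → (Fin 2 → ℝ)} {p : Fin 4 → ℝ}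
    (hg : DifferentiableAt ℝ g (jet1 p)) (hf : DifferentiableAt ℝ f (g (jet1 p))) :
    totalDeriv1 (fun m => f (g m)) p = fderiv ℝ f (g (jet1 p))
      ![totalDeriv1 (fun m => g m 0) p, totalDeriv1 (fun m => g m 1) p] := by
  have h := (hf.hasFDerivAt.comp (jet1 p) hg.hasFDerivAt).fderiv
  simp only [Function.comp_def] at h
  rw [totalDeriv1, h, ContinuousLinearMap.comp_apply]
  congr 1
  ext i
  rw [fderiv_apply_coord hg]
  fin_cases i <;> rfl

theorem totalDeriv1_mul {f g : (Fin 3 → ℝ) → ℝ} {p : Fin 4 → ℝ}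
    (hf : DifferentiableAt ℝ f (jet1 p)) (hg : DifferentiableAt ℝ g (jet1 p)) :
    totalDeriv1 (fun q => f q * g q) p =
      totalDeriv1 f p * g (jet1 p) + f (jet1 p) * totalDeriv1 g p := by
  have h := (hf.hasFDerivAt.mul hg.hasFDerivAt).fderiv
  have e : (fun q => f q * g q) = f * g := rfl
  rw [totalDeriv1, e, h]
  simp [totalDeriv1]
  ring

theorem totalDeriv1_congr {f g : (Fin 3 → ℝ) → ℝ} {p : Fin 4 → ℝ} (h : f =ᶠ[𝓝 (jet1 p)] g) :
    totalDeriv1 f p = totalDeriv1 g p := by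
  rw [totalDeriv1, h.fderiv_eq, totalDeriv1]

theorem totalDeriv0_congr {f g : (Fin 2 → ℝ) → ℝ} {q : Fin 3 → ℝ} (h : f =ᶠ[𝓝 (base3 q)] g) :
    totalDeriv0 f q = totalDeriv0 g q := by
  rw [totalDeriv0, h.fderiv_eq, totalDeriv0]

/-! ### Images of the vector fields in the reduced space -/

/-- The differential of `(x, u, u₁, u₂) ↦ (y, w, w₁)`, by coordinates. -/
theorem fderiv_reduce2_apply {χ : (Fin 2 → ℝ) → (Fin 2 → ℝ)} {p : Fin 4 → ℝ}
    (hχ : ContDiffAt ℝ ∞ χ (base4 p)) (h0 : totalDeriv0 (fun m => χ m 0) (jet1 p) ≠ 0)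
    (V : Fin 4 → ℝ) :
    fderiv ℝ (reduce2 χ) p V = ![fderiv ℝ χ (base4 p) (base4 V) 0,
      fderiv ℝ (alpha1 χ) (jet1 p) (jet1 V), fderiv ℝ (alpha2 χ) p V] := by
  have h := (contDiffAt_reduce2 hχ h0).differentiableAt (by simp)
  have hy := (contDiffAt_pi.1 hχ 0).differentiableAt (by simp)
  have hα := (contDiffAt_alpha1 (q := jet1 p) hχ h0).differentiableAt (by simp)
  ext i
  rw [fderiv_apply_coord h]
  fin_cases i
  · change fderiv ℝ (fun z => χ (base3 (jet1 z)) 0) p V = _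
    have e := fderiv_comp_jet1 (f := fun q => χ (base3 q) 0) (p := p)
      (DifferentiableAt.comp (g := fun m => χ m 0) (jet1 p) hy
        (hasFDerivAt_base3 _).differentiableAt) V
    rw [e, fderiv_comp_base3 (q := jet1 p) hy]
    exact (fderiv_apply_coord (hχ.differentiableAt (by simp)) _ 0).symm
  · exact fderiv_comp_jet1 hα V
  · rfl

/-- The total derivative field is carried to `D_x y` times the field of the reduced equation. -/
theorem fderiv_reduce2_odeField3 {Φ : (Fin 4 → ℝ) → ℝ} {Ψ : (Fin 3 → ℝ) → ℝ}
    {χ : (Fin 2 → ℝ) → (Fin 2 → ℝ)} {p : Fin 4 → ℝ}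
    (hχ : ContDiffAt ℝ ∞ χ (base4 p)) (h0 : totalDeriv0 (fun m => χ m 0) (jet1 p) ≠ 0)
    (hred : along (odeField3 Φ) (alpha2 χ) p / totalDeriv0 (fun m => χ m 0) (jet1 p) =
      Ψ (reduce2 χ p)) :
    fderiv ℝ (reduce2 χ) p (odeField3 Φ p) =
      totalDeriv0 (fun m => χ m 0) (jet1 p) • odeField2 Ψ (reduce2 χ p) := by
  -- The components of the image are D_x y, D_x α₁ = α₂ D_x y and A(α₂); the reduced equation
  -- determines the last.
  rw [fderiv_reduce2_apply hχ h0, odeField2, ← hred, along]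
  ext i
  fin_cases i
  · simp only [Fin.zero_eta, Matrix.cons_val_zero, Pi.smul_apply, smul_eq_mul, mul_one]
    rw [fderiv_apply_coord (hχ.differentiableAt (by simp))]
    rfl
  · have e : reduce2 χ p 2 = totalDeriv1 (alpha1 χ) p / totalDeriv0 (fun m => χ m 0) (jet1 p) := rfl
    simp only [Fin.mk_one, Matrix.cons_val_one, Matrix.cons_val_zero, Pi.smul_apply, smul_eq_mul, e]
    rw [mul_div_cancel₀ _ h0]
    rfl
  · simp
    field_simp

theorem contDiffAt_along {n : ℕ} {V : (Fin n → ℝ) → (Fin n → ℝ)} {f : (Fin n → ℝ) → ℝ}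
    {p : Fin n → ℝ} (hf : ContDiffAt ℝ ∞ f p) (hV : ContDiffAt ℝ ∞ V p) :
    ContDiffAt ℝ ∞ (along V f) p :=
  (hf.fderiv_right (m := ∞) (by norm_cast)).clm_apply hV

theorem along_coord {n : ℕ} {V f : (Fin n → ℝ) → (Fin n → ℝ)} {p : Fin n → ℝ}
    (hf : DifferentiableAt ℝ f p) (i : Fin n) :
    along V (fun z => f z i) p = fderiv ℝ f p (V p) i :=
  (fderiv_apply_coord hf _ i).symm

/-- The image of `v^{(2)}` under the differential of `(x, u, u₁, u₂) ↦ (y, w, w₁)`. -/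
theorem fderiv_reduce2_prolong2 {χ v : (Fin 2 → ℝ) → (Fin 2 → ℝ)} {p : Fin 4 → ℝ}
    (hχ : ContDiffAt ℝ ∞ χ (base4 p)) (hv : ContDiffAt ℝ ∞ v (base4 p))
    (h0 : totalDeriv0 (fun m => χ m 0) (jet1 p) ≠ 0) :
    fderiv ℝ (reduce2 χ) p (prolong2 v p) =
      ![along v (fun m => χ m 0) (base4 p), along (prolong1 v) (alpha1 χ) (jet1 p),
        (totalDeriv1 (along (prolong1 v) (alpha1 χ)) p -
          alpha2 χ p * totalDeriv0 (along v fun m => χ m 0) (jet1 p)) /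
            totalDeriv0 (fun m => χ m 0) (jet1 p)] := by
  rw [fderiv_reduce2_apply hχ h0, ← along_prolong2_alpha2 hχ hv h0,
    along_coord (hχ.differentiableAt (by simp))]
  have e : base4 (prolong2 v p) = v (base4 p) := by
    ext i; fin_cases i <;> rfl
  rw [e]
  rfl

theorem eventually_totalDeriv0_ne_zero {χ : (Fin 2 → ℝ) → (Fin 2 → ℝ)} {q : Fin 3 → ℝ}
    (hχ : ContDiffAt ℝ ∞ χ (base3 q)) (h0 : totalDeriv0 (fun m => χ m 0) q ≠ 0) :
    ∀ᶠ z in 𝓝 q, totalDeriv0 (fun m => χ m 0) z ≠ 0 :=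
  (contDiffAt_totalDeriv0 (contDiffAt_pi.1 hχ 0)).continuousAt.eventually_ne h0

/-- The prolongation of `∂_α` is projected to zero. -/
theorem fderiv_reduce2_prolong2_canonical {χ v : (Fin 2 → ℝ) → (Fin 2 → ℝ)} {p : Fin 4 → ℝ}
    {s : Set (Fin 2 → ℝ)} (hs : IsOpen s) (hp : base4 p ∈ s)
    (hχ : ContDiffOn ℝ ∞ χ s) (hv : ContDiffOn ℝ ∞ v s)
    (hcanon : ∀ m ∈ s, fderiv ℝ χ m (v m) = ![0, 1])
    (h0 : totalDeriv0 (fun m => χ m 0) (jet1 p) ≠ 0) :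
    fderiv ℝ (reduce2 χ) p (prolong2 v p) = 0 := by
  have hχ' : ∀ m ∈ s, ContDiffAt ℝ ∞ χ m := fun m hm => hχ.contDiffAt (hs.mem_nhds hm)
  have hv' : ∀ m ∈ s, ContDiffAt ℝ ∞ v m := fun m hm => hv.contDiffAt (hs.mem_nhds hm)
  -- Both v(y) = 0 and v(α) = 1 are constant, so their total derivatives vanish; hence α₁, and then
  -- α₂, are invariant.
  have hz : ∀ q : Fin 3 → ℝ, base3 q ∈ s → ∀ i, totalDeriv0 (along v fun m => χ m i) q = 0 := by
    intro q hq i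
    have e : (along v fun m => χ m i) =ᶠ[𝓝 (base3 q)] fun _ => (![0, 1] : Fin 2 → ℝ) i := by
      filter_upwards [hs.mem_nhds hq] with m hm
      rw [along_coord ((hχ' m hm).differentiableAt (by simp)), hcanon m hm]
    rw [totalDeriv0_congr e]
    simp [totalDeriv0]
  have hα : along (prolong1 v) (alpha1 χ) =ᶠ[𝓝 (jet1 p)] fun _ => 0 := by
    filter_upwards [eventually_totalDeriv0_ne_zero (q := jet1 p) (hχ' _ hp) h0,
      contDiff_base3.continuous.continuousAt.preimage_mem_nhds (hs.mem_nhds hp)] with q hq hqs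
    rw [along_prolong1_alpha1 (hχ' _ hqs) (hv' _ hqs) hq, hz q hqs 0, hz q hqs 1]
    simp
  rw [fderiv_reduce2_prolong2 (hχ' _ hp) (hv' _ hp) h0, hz (jet1 p) hp, totalDeriv1_congr hα,
    hα.self_of_nhds, along_coord ((hχ' _ hp).differentiableAt (by simp)), hcanon _ hp]
  ext i
  fin_cases i <;> simp [totalDeriv1]

theorem fderiv_reduce1_apply {χ : (Fin 2 → ℝ) → (Fin 2 → ℝ)} {q : Fin 3 → ℝ}
    (hχ : ContDiffAt ℝ ∞ χ (base3 q)) (h0 : totalDeriv0 (fun m => χ m 0) q ≠ 0)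
    (v : (Fin 2 → ℝ) → (Fin 2 → ℝ)) :
    fderiv ℝ (reduce1 χ) q (prolong1 v q) =
      ![along v (fun m => χ m 0) (base3 q), along (prolong1 v) (alpha1 χ) q] := by
  have h := (contDiffAt_reduce1 hχ h0).differentiableAt (by simp)
  ext i
  rw [fderiv_apply_coord h]
  fin_cases i
  · exact along_prolong1_comp_base3 ((contDiffAt_pi.1 hχ 0).differentiableAt (by simp))
  · rfl

/-- The total derivative of a function of `(y, w)`. -/
theorem totalDeriv1_comp_reduce1 {χ : (Fin 2 → ℝ) → (Fin 2 → ℝ)} {f : (Fin 2 → ℝ) → ℝ}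
    {p : Fin 4 → ℝ} (hχ : ContDiffAt ℝ ∞ χ (base4 p))
    (h0 : totalDeriv0 (fun m => χ m 0) (jet1 p) ≠ 0)
    (hf : DifferentiableAt ℝ f (reduce1 χ (jet1 p))) :
    totalDeriv1 (fun q => f (reduce1 χ q)) p =
      totalDeriv0 (fun m => χ m 0) (jet1 p) * totalDeriv0 f (reduce2 χ p) := by
  have h := (contDiffAt_reduce1 (q := jet1 p) hχ h0).differentiableAt (by simp)
  have hy : totalDeriv1 (fun q => reduce1 χ q 0) p = totalDeriv0 (fun m => χ m 0) (jet1 p) :=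
    totalDeriv1_comp_base3 ((contDiffAt_pi.1 hχ 0).differentiableAt (by simp))
  have hα : totalDeriv1 (fun q => reduce1 χ q 1) p =
      totalDeriv0 (fun m => χ m 0) (jet1 p) * alpha2 χ p :=
    (mul_div_cancel₀ _ h0).symm
  have e : (![totalDeriv0 (fun m => χ m 0) (jet1 p),
      totalDeriv0 (fun m => χ m 0) (jet1 p) * alpha2 χ p] : Fin 2 → ℝ) =
      totalDeriv0 (fun m => χ m 0) (jet1 p) • ![1, reduce2 χ p 2] := by
    ext i
    fin_cases i
    · simp
    · rfl
  rw [totalDeriv1_comp h hf, hy, hα, e, map_smul, smul_eq_mul]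
  rfl

/-- The prolongation `v^{(2)}`, multiplied by `ς`, is projected to the `λ`-prolongation of the
projection of `ς v^{(1)}`, where `λ = -(D_x ς / D_x y) / ς`. -/
theorem fderiv_reduce2_smul_prolong2 {χ v vbar : (Fin 2 → ℝ) → (Fin 2 → ℝ)}
    {ς : (Fin 2 → ℝ) → ℝ} {lam : (Fin 3 → ℝ) → ℝ} {p : Fin 4 → ℝ}
    (hχe : ∀ᶠ m in 𝓝 (base4 p), ContDiffAt ℝ ∞ χ m) (hv : ContDiffAt ℝ ∞ v (base4 p))
    (h0 : totalDeriv0 (fun m => χ m 0) (jet1 p) ≠ 0)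
    (hς : ContDiffAt ℝ ∞ ς (base4 p)) (hς0 : ς (base4 p) ≠ 0)
    (hvbar : ContDiffAt ℝ ∞ vbar (reduce1 χ (jet1 p)))
    (hproj : ∀ᶠ q in 𝓝 (jet1 p),
      fderiv ℝ (reduce1 χ) q (ς (base3 q) • prolong1 v q) = vbar (reduce1 χ q))
    (hlam : lam (reduce2 χ p) =
      -(totalDeriv0 ς (jet1 p) / totalDeriv0 (fun m => χ m 0) (jet1 p)) / ς (base4 p)) :
    fderiv ℝ (reduce2 χ) p (ς (base4 p) • prolong2 v p) =
      lambdaProlong vbar lam (reduce2 χ p) := by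
  have hχ := hχe.self_of_nhds
  have hχ3 : ∀ᶠ q in 𝓝 (jet1 p), ContDiffAt ℝ ∞ χ (base3 q) :=
    contDiff_base3.continuous.continuousAt.eventually
      (p := fun m => ContDiffAt ℝ ∞ χ m) hχe
  -- A whole neighbourhood is needed, since both identities are differentiated along D_x below.
  have hev : ∀ᶠ q in 𝓝 (jet1 p),
      ς (base3 q) * along v (fun m => χ m 0) (base3 q) = vbar (reduce1 χ q) 0 ∧
      ς (base3 q) * along (prolong1 v) (alpha1 χ) q = vbar (reduce1 χ q) 1 := by
    filter_upwards [hχ3, hproj, eventually_totalDeriv0_ne_zero (q := jet1 p) hχ h0]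
      with q hq1 hq2 hq3
    rw [map_smul, fderiv_reduce1_apply hq1 hq3] at hq2
    exact ⟨congrFun hq2 0, congrFun hq2 1⟩
  have hςd : DifferentiableAt ℝ ς (base4 p) := hς.differentiableAt (by simp)
  have hςb : DifferentiableAt ℝ (fun q => ς (base3 q)) (jet1 p) :=
    DifferentiableAt.comp (g := ς) (jet1 p) hςd (hasFDerivAt_base3 _).differentiableAt
  have hH : DifferentiableAt ℝ (along v fun m => χ m 0) (base4 p) :=
    (contDiffAt_along (contDiffAt_pi.1 hχ 0) hv).differentiableAt (by simp)
  have hHb : DifferentiableAt ℝ (fun q => along v (fun m => χ m 0) (base3 q)) (jet1 p) :=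
    DifferentiableAt.comp (g := along v fun m => χ m 0) (jet1 p) hH
      (hasFDerivAt_base3 _).differentiableAt
  have hG : DifferentiableAt ℝ (along (prolong1 v) (alpha1 χ)) (jet1 p) :=
    (contDiffAt_along (contDiffAt_alpha1 (q := jet1 p) hχ h0)
      (contDiffAt_prolong1 (q := jet1 p) hv)).differentiableAt (by simp)
  have hvb : ∀ i, DifferentiableAt ℝ (fun m => vbar m i) (reduce1 χ (jet1 p)) := fun i =>
    (contDiffAt_pi.1 hvbar i).differentiableAt (by simp)
  have e0 := totalDeriv1_congr (p := p) (hev.mono fun q hq => hq.1)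
  have e1 := totalDeriv1_congr (p := p) (hev.mono fun q hq => hq.2)
  rw [totalDeriv1_mul hςb hHb, totalDeriv1_comp_base3 hςd, totalDeriv1_comp_base3 hH,
    totalDeriv1_comp_reduce1 hχ h0 (hvb 0)] at e0
  rw [totalDeriv1_mul hςb hG, totalDeriv1_comp_base3 hςd,
    totalDeriv1_comp_reduce1 hχ h0 (hvb 1)] at e1
  obtain ⟨f0, f1⟩ := hev.self_of_nhds
  simp only [base3_jet1] at e0 e1 f0 f1
  have hb : base3 (reduce2 χ p) = reduce1 χ (jet1 p) := by
    ext i; fin_cases i <;> rfl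
  have h2 : reduce2 χ p 2 = alpha2 χ p := rfl
  rw [map_smul, fderiv_reduce2_prolong2 hχ hv h0, lambdaProlong, hb, ← f0, ← f1, hlam, h2]
  ext i
  fin_cases i
  · simp
  · simp
  -- The differentiated identities are solved for D_y ξ and D_y η; their D_x ς terms then cancel the
  -- λ terms.
  · have k0 : totalDeriv0 (fun m => vbar m 0) (reduce2 χ p) = _ :=
      eq_div_of_mul_eq h0 ((mul_comm _ _).trans e0.symm)
    have k1 : totalDeriv0 (fun m => vbar m 1) (reduce2 χ p) = _ :=
      eq_div_of_mul_eq h0 ((mul_comm _ _).trans e1.symm)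
    simp [k0, k1]
    field_simp
    ring

/-- `A_{(y,α)}(ς) = D_x ς / D_x y` for a function `ς(x, u)`. -/
theorem along_odeField3_comp_symm {χ : OpenPartialHomeomorph (Fin 2 → ℝ) (Fin 2 → ℝ)}
    {Θ : (Fin 4 → ℝ) → ℝ} {ς : (Fin 2 → ℝ) → ℝ} {p : Fin 4 → ℝ} (hp : base4 p ∈ χ.source)
    (hχ : ContDiffAt ℝ ∞ χ (base4 p)) (hχs : ContDiffAt ℝ ∞ χ.symm (χ (base4 p)))
    (hς : DifferentiableAt ℝ ς (base4 p))
    (h0 : totalDeriv0 (fun m => χ m 0) (jet1 p) ≠ 0) :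
    along (odeField3 Θ) (fun P => ς (χ.symm (base4 P))) (prolongMap2 χ p) =
      totalDeriv0 ς (jet1 p) / totalDeriv0 (fun m => χ m 0) (jet1 p) := by
  have hb : base4 (prolongMap2 χ p) = χ (base4 p) := by
    ext i; fin_cases i <;> rfl
  have hg : DifferentiableAt ℝ (fun m => ς (χ.symm m)) (χ (base4 p)) := by
    refine DifferentiableAt.comp (g := ς) _ ?_ (hχs.differentiableAt (by simp))
    rwa [χ.left_inv hp]
  -- Writing ς as a function of (y, α) reduces the claim to D_x(y, α) = D_x y · (1, α₁); Θ plays no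
  -- role, as ς involves no derivatives.
  have e : ς =ᶠ[𝓝 (base3 (jet1 p))] fun m => ς (χ.symm (χ m)) := by
    filter_upwards [χ.open_source.mem_nhds hp] with m hm
    rw [χ.left_inv hm]
  rw [totalDeriv0_congr e, totalDeriv0_comp (f := fun m => ς (χ.symm m)) (q := jet1 p)
    (hχ.differentiableAt (by simp)) hg]
  have hg' : DifferentiableAt ℝ (fun m => ς (χ.symm m)) (base3 (jet1 (prolongMap2 χ p))) := by
    rw [base3_jet1, hb]; exact hg
  have k := fderiv_comp_jet1 (f := fun q => ς (χ.symm (base3 q))) (p := prolongMap2 χ p)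
    (DifferentiableAt.comp (g := fun m => ς (χ.symm m)) _ hg'
      (hasFDerivAt_base3 _).differentiableAt) (odeField3 Θ (prolongMap2 χ p))
  rw [fderiv_comp_base3 hg', base3_jet1, base3_jet1, hb] at k
  refine k.trans ?_
  rw [eq_div_iff h0, mul_comm, ← smul_eq_mul, ← map_smul, base3_jet1]
  congr 1
  ext i
  fin_cases i
  · simp [base4, odeField3]
  · exact mul_div_cancel₀ _ h0

/-! ### The reduction map is a submersion -/

/-- D_x f is affine in u₁ with slope f_u. -/
theorem fderiv_totalDeriv0_vertical {f : (Fin 2 → ℝ) → ℝ} {q : Fin 3 → ℝ}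
    (hf : ContDiffAt ℝ ∞ f (base3 q)) (t : ℝ) :
    fderiv ℝ (totalDeriv0 f) q ![0, 0, t] = fderiv ℝ f (base3 q) ![0, t] := by
  have h := fderiv_fderiv_apply_apply hf (hasFDerivAt_base3 q) (hasFDerivAt_vec2 q) ![0, 0, t]
  have e : base3L ![0, 0, t] = 0 := by
    rw [base3L_apply]; ext i; fin_cases i <;> rfl
  refine h.trans ?_
  rw [e, shift3L_apply]
  simp

theorem fderiv_totalDeriv1_vertical {f : (Fin 3 → ℝ) → ℝ} {p : Fin 4 → ℝ}
    (hf : ContDiffAt ℝ ∞ f (jet1 p)) (t : ℝ) :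
    fderiv ℝ (totalDeriv1 f) p ![0, 0, 0, t] = fderiv ℝ f (jet1 p) ![0, 0, t] := by
  have h := fderiv_fderiv_apply_apply hf (hasFDerivAt_jet1 p) (hasFDerivAt_vec3 p) ![0, 0, 0, t]
  have e : jet1L ![0, 0, 0, t] = 0 := by
    rw [jet1L_apply]; ext i; fin_cases i <;> rfl
  refine h.trans ?_
  rw [e, shift4L_apply]
  simp

/-- `α₁` is a local coordinate on the fibres of `(x, u, u₁) ↦ (x, u)`. -/
theorem eq_zero_of_fderiv_alpha1_vertical {χ : (Fin 2 → ℝ) → (Fin 2 → ℝ)} {q : Fin 3 → ℝ} {t : ℝ}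
    (hχ : ContDiffAt ℝ ∞ χ (base3 q)) (hinj : Function.Injective (fderiv ℝ χ (base3 q)))
    (h0 : totalDeriv0 (fun m => χ m 0) q ≠ 0)
    (ht : fderiv ℝ (alpha1 χ) q ![0, 0, t] = 0) : t = 0 := by
  have h := contDiffAt_pi.1 hχ
  have hd := hχ.differentiableAt (by simp)
  have e := along_div (V := fun _ => ![0, 0, t])
    ((contDiffAt_totalDeriv0 (h 1)).differentiableAt (by simp))
    ((contDiffAt_totalDeriv0 (h 0)).differentiableAt (by simp)) h0
  have e' := e.symm.trans ht
  rw [div_eq_zero_iff, or_iff_left h0, along, along, fderiv_totalDeriv0_vertical (h 1),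
    fderiv_totalDeriv0_vertical (h 0), sub_eq_zero, div_mul_eq_mul_div, eq_div_iff h0] at e'
  -- If α₁ were stationary along the fibre, dχ would send (0, t) and (1, u₁) to parallel vectors;
  -- this combination then lies in its kernel, and injectivity forces t = 0.
  have key : fderiv ℝ χ (base3 q) (totalDeriv0 (fun m => χ m 0) q • ![0, t] -
      (fderiv ℝ (fun m => χ m 0) (base3 q) ![0, t]) • ![1, q 2]) = 0 := by
    ext i
    rw [map_sub, map_smul, map_smul]
    simp only [Pi.sub_apply, Pi.smul_apply, smul_eq_mul, fderiv_apply_coord hd, Pi.zero_apply]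
    fin_cases i
    · simp only [totalDeriv0, Fin.zero_eta]
      ring
    · simp only [totalDeriv0] at e' ⊢
      simp only [Fin.mk_one]
      linarith
  have k := hinj (key.trans (map_zero _).symm)
  have k0 := congrFun k 0
  have k1 := congrFun k 1
  simp at k0 k1
  rw [k0] at k1
  simpa [h0] using k1

/-- `α₂` is a local coordinate on the fibres of `(x, u, u₁, u₂) ↦ (x, u, u₁)`. -/
theorem eq_zero_of_fderiv_alpha2_vertical {χ : (Fin 2 → ℝ) → (Fin 2 → ℝ)} {p : Fin 4 → ℝ} {t : ℝ}
    (hχ : ContDiffAt ℝ ∞ χ (base4 p)) (hinj : Function.Injective (fderiv ℝ χ (base4 p)))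
    (h0 : totalDeriv0 (fun m => χ m 0) (jet1 p) ≠ 0)
    (ht : fderiv ℝ (alpha2 χ) p ![0, 0, 0, t] = 0) : t = 0 := by
  have hα := contDiffAt_alpha1 (q := jet1 p) hχ h0
  have hy := contDiffAt_totalDeriv0 (q := jet1 p) (contDiffAt_pi.1 hχ 0)
  have e := along_div (V := fun _ => ![0, 0, 0, t])
    ((contDiffAt_totalDeriv1 hα).differentiableAt (by simp))
    ((hy.comp p contDiff_jet1.contDiffAt).differentiableAt (by simp)) h0
  have e' := e.symm.trans ht
  have hj : jet1 ![0, 0, 0, t] = 0 := by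
    ext i; fin_cases i <;> rfl
  -- D_x y does not involve u₂, so ∂α₂/∂u₂ is ∂α₁/∂u₁ divided by D_x y.
  have e2 : fderiv ℝ (totalDeriv0 (fun m => χ m 0) ∘ jet1) p ![0, 0, 0, t] = 0 := by
    refine (fderiv_comp_jet1 (hy.differentiableAt (by simp)) _).trans ?_
    rw [hj, map_zero]
  rw [div_eq_zero_iff, or_iff_left (by exact h0), along, along, fderiv_totalDeriv1_vertical hα, e2, mul_zero,
    sub_zero] at e'
  exact eq_zero_of_fderiv_alpha1_vertical (q := jet1 p) hχ hinj h0 e'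

/-- The prolonged change of variables is triangular: (y, α) determines the (x, u)-components of a
vector, then α₁ the u₁-component, then α₂ the u₂-component. -/
theorem eq_zero_of_fderiv_reduce2_eq_zero {χ : (Fin 2 → ℝ) → (Fin 2 → ℝ)} {p a : Fin 4 → ℝ}
    (hχ : ContDiffAt ℝ ∞ χ (base4 p)) (hinj : Function.Injective (fderiv ℝ χ (base4 p)))
    (h0 : totalDeriv0 (fun m => χ m 0) (jet1 p) ≠ 0)
    (ha : fderiv ℝ (reduce2 χ) p a = 0) (hα : fderiv ℝ χ (base4 p) (base4 a) 1 = 0) : a = 0 := by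
  rw [fderiv_reduce2_apply hχ h0] at ha
  have a0 : fderiv ℝ χ (base4 p) (base4 a) 0 = 0 := congrFun ha 0
  have a1 : fderiv ℝ (alpha1 χ) (jet1 p) (jet1 a) = 0 := congrFun ha 1
  have a2 : fderiv ℝ (alpha2 χ) p a = 0 := congrFun ha 2
  have hb : base4 a = 0 := by
    refine hinj (Eq.trans ?_ (map_zero _).symm)
    ext i; fin_cases i
    · exact a0
    · exact hα
  have z0 : a 0 = 0 := congrFun hb 0
  have z1 : a 1 = 0 := congrFun hb 1
  have hj : jet1 a = ![0, 0, a 2] := by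
    ext i; fin_cases i
    · exact z0
    · exact z1
    · rfl
  rw [hj] at a1
  have z2 : a 2 = 0 := eq_zero_of_fderiv_alpha1_vertical (q := jet1 p) hχ hinj h0 a1
  have hv : a = ![0, 0, 0, a 3] := by
    ext i; fin_cases i
    · exact z0
    · exact z1
    · exact z2
    · rfl
  rw [hv] at a2
  have z3 : a 3 = 0 := eq_zero_of_fderiv_alpha2_vertical hχ hinj h0 a2
  rw [hv, z3]
  ext i; fin_cases i <;> rfl

/-- The map `(x, u, u₁, u₂) ↦ (y, w, w₁)` is a submersion. -/
theorem fderiv_reduce2_surjective {χ : (Fin 2 → ℝ) → (Fin 2 → ℝ)} {p : Fin 4 → ℝ}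
    (hχ : ContDiffAt ℝ ∞ χ (base4 p)) (hinj : Function.Injective (fderiv ℝ χ (base4 p)))
    (h0 : totalDeriv0 (fun m => χ m 0) (jet1 p) ≠ 0) :
    Function.Surjective (fderiv ℝ (reduce2 χ) p) := by
  set L : (Fin 4 → ℝ) →ₗ[ℝ] (Fin 3 → ℝ) := (fderiv ℝ (reduce2 χ) p : (Fin 4 → ℝ) →ₗ[ℝ] (Fin 3 → ℝ))
    with hL
  -- This is dα. It is injective on the kernel of dπ, which therefore has dimension at most 1, and
  -- rank-nullity gives rank 3.
  let g : (Fin 4 → ℝ) →ₗ[ℝ] ℝ :=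
    ((ContinuousLinearMap.proj 1).comp
      ((fderiv ℝ χ (base4 p)).comp (base3L.comp jet1L)) : (Fin 4 → ℝ) →L[ℝ] ℝ)
  have hg : ∀ a, g a = fderiv ℝ χ (base4 p) (base4 a) 1 := by
    intro a
    change fderiv ℝ χ (base4 p) (base3L (jet1L a)) 1 = _
    rw [jet1L_apply, base3L_apply, base3_jet1]
  have hker : Function.Injective (g.domRestrict (LinearMap.ker L)) := by
    refine (injective_iff_map_eq_zero _).2 fun a ha => ?_
    refine Subtype.ext (eq_zero_of_fderiv_reduce2_eq_zero hχ hinj h0 a.2 ?_)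
    rw [← hg]
    exact ha
  have h1 : Module.finrank ℝ (LinearMap.ker L) ≤ 1 := by
    simpa using LinearMap.finrank_le_finrank_of_injective hker
  have h2 := LinearMap.finrank_range_add_finrank_ker L
  have h3 : Module.finrank ℝ (LinearMap.range L) ≤ Module.finrank ℝ (Fin 3 → ℝ) :=
    Submodule.finrank_le _
  simp only [Module.finrank_fin_fun] at h2 h3
  have h4 : LinearMap.range L = ⊤ :=
    Submodule.eq_top_of_finrank_eq (by simp only [Module.finrank_fin_fun]; omega)
  exact LinearMap.range_eq_top.1 h4

/-! ### Functional independence from independent differentials -/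

/-- A function with vanishing differential on a nonempty open set is constant on a nonempty open
subset. -/
theorem exists_isOpen_const_of_fderiv_eq_zero {n : ℕ} {f : (Fin n → ℝ) → ℝ} {U : Set (Fin n → ℝ)}
    (hU : IsOpen U) (hne : U.Nonempty) (hf : DifferentiableOn ℝ f U)
    (h : ∀ p ∈ U, fderiv ℝ f p = 0) :
    ∃ V ⊆ U, IsOpen V ∧ V.Nonempty ∧ ∃ c, ∀ p ∈ V, f p = c := by
  obtain ⟨p, hp⟩ := hne
  obtain ⟨r, hr, hrU⟩ := Metric.isOpen_iff.1 hU p hp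
  refine ⟨Metric.ball p r, hrU, Metric.isOpen_ball, ⟨p, Metric.mem_ball_self hr⟩, f p, ?_⟩
  intro z hz
  exact (convex_ball p r).is_const_of_fderivWithin_eq_zero (hf.mono hrU)
    (fun w hw => by rw [fderivWithin_of_isOpen Metric.isOpen_ball hw, h w (hrU hw)]) hz
    (Metric.mem_ball_self hr)

/-- The points where the differential of a nowhere locally constant function is nonzero are
dense. -/
theorem IsFirstIntegralOn.exists_fderiv_ne_zero {n : ℕ} {A : (Fin n → ℝ) → (Fin n → ℝ)}
    {f : (Fin n → ℝ) → ℝ} {D U : Set (Fin n → ℝ)} (hf : IsFirstIntegralOn A f D)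
    (hUD : U ⊆ D) (hU : IsOpen U) (hne : U.Nonempty) : ∃ p ∈ U, fderiv ℝ f p ≠ 0 := by
  by_contra! hcon
  obtain ⟨V, hVU, hV, hVne, hc⟩ := exists_isOpen_const_of_fderiv_eq_zero hU hne
    ((hf.smooth.mono hUD).differentiableOn (by simp)) hcon
  exact hf.nonconstant V (hVU.trans hUD) hV hVne hc

/-- Two first integrals whose differentials are independent wherever they are both nonzero are
functionally independent. -/
theorem IsFirstIntegralOn.functionallyIndependentOn {n : ℕ} {A B : (Fin n → ℝ) → (Fin n → ℝ)}
    {f g : (Fin n → ℝ) → ℝ} {D : Set (Fin n → ℝ)} (hD : IsOpen D)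
    (hf : IsFirstIntegralOn A f D) (hg : IsFirstIntegralOn B g D)
    (h : ∀ p ∈ D, fderiv ℝ f p ≠ 0 → fderiv ℝ g p ≠ 0 →
      LinearIndependent ℝ ![fderiv ℝ f p, fderiv ℝ g p]) :
    FunctionallyIndependentOn f g D := by
  rintro U hUD hU ⟨p, hp⟩ hdep
  obtain ⟨V, hV, hpV, R, -, hR, hRz⟩ := hdep p hp
  have hVU : IsOpen (V ∩ U) := hV.inter hU
  have hVUD : V ∩ U ⊆ D := Set.inter_subset_right.trans hUD
  -- Since df ≠ 0 is an open condition, a point with dg ≠ 0 can be sought inside the set where it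
  -- holds.
  obtain ⟨p₁, hp₁, hf₁⟩ := hf.exists_fderiv_ne_zero hVUD hVU ⟨p, hpV, hp⟩
  have hcont : ContinuousOn (fderiv ℝ f) D :=
    hf.smooth.continuousOn_fderiv_of_isOpen hD (by simp)
  have hev : ∀ᶠ z in 𝓝 p₁, fderiv ℝ f z ≠ 0 :=
    (hcont.continuousAt (hD.mem_nhds (hVUD hp₁))).eventually_ne hf₁
  obtain ⟨W, hWsub, hW, hpW⟩ := mem_nhds_iff.1 hev
  obtain ⟨z, hz, hgz⟩ := hg.exists_fderiv_ne_zero (U := W ∩ (V ∩ U))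
    (Set.inter_subset_right.trans hVUD) (hW.inter hVU) ⟨p₁, hpW, hp₁⟩
  have hzD : z ∈ D := hVUD hz.2
  have hlin := h z hzD (hWsub hz.1) hgz
  have hfz := (hf.smooth.contDiffAt (hD.mem_nhds hzD)).hasStrictFDerivAt (by simp)
  have hgz' := (hg.smooth.contDiffAt (hD.mem_nhds hzD)).hasStrictFDerivAt (by simp)
  have hpair : HasStrictFDerivAt (fun q => (![f q, g q] : Fin 2 → ℝ))
      (ContinuousLinearMap.pi ![fderiv ℝ f z, fderiv ℝ g z]) z := by
    refine hasStrictFDerivAt_pi'.2 fun i => ?_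
    fin_cases i
    · exact hfz
    · exact hgz'
  have hsurj : (ContinuousLinearMap.pi ![fderiv ℝ f z, fderiv ℝ g z] :
      (Fin n → ℝ) →L[ℝ] (Fin 2 → ℝ)).range = ⊤ := by
    by_contra hne
    -- A nonzero functional vanishing on the range would be a linear relation between df and dg.
    obtain ⟨φ, hφ, hle⟩ := Submodule.exists_le_ker_of_lt_top _ (lt_top_iff_ne_top.2 hne)
    refine hφ ?_
    have hsum : φ ![1, 0] • fderiv ℝ f z + φ ![0, 1] • fderiv ℝ g z = 0 := by
      ext V
      have hk : φ (![fderiv ℝ f z V, fderiv ℝ g z V]) = 0 := by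
        refine LinearMap.mem_ker.1 (hle ⟨V, ?_⟩)
        ext i; fin_cases i <;> rfl
      have e : (![fderiv ℝ f z V, fderiv ℝ g z V] : Fin 2 → ℝ) =
          fderiv ℝ f z V • ![1, 0] + fderiv ℝ g z V • ![0, 1] := by
        ext i; fin_cases i <;> simp
      rw [e, map_add, map_smul, map_smul] at hk
      simpa [mul_comm] using hk
    obtain ⟨c0, c1⟩ := LinearIndependent.pair_iff.1 hlin _ _ hsum
    refine LinearMap.ext fun z => ?_
    have e : z = z 0 • ![1, 0] + z 1 • ![0, 1] := by
      ext i; fin_cases i <;> simp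
    rw [e, map_add, map_smul, map_smul, c0, c1]
    simp
  -- By the open mapping property of submersions, the values of (f, g) fill a neighbourhood, on
  -- which R would have to vanish.
  have hmap := hpair.map_nhds_eq_of_surj hsurj
  have himg : (fun q => (![f q, g q] : Fin 2 → ℝ)) '' (V ∩ U) ∈ 𝓝 (![f z, g z] : Fin 2 → ℝ) := by
    rw [← hmap]
    exact image_mem_map (hVU.mem_nhds hz.2)
  obtain ⟨O, hO, hOo, hzO⟩ := mem_nhds_iff.1 himg
  obtain ⟨y, hy, hRy⟩ := hR O hOo ⟨_, hzO⟩
  obtain ⟨q, hq, rfl⟩ := hO hy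
  exact hRy (hRz q hq)

/-! ### Pullback of first integrals and separation by a frame -/

theorem fderiv_injective_of_mem_source {E : Type*} [NormedAddCommGroup E] [NormedSpace ℝ E]
    {χ : OpenPartialHomeomorph E E} {m : E}
    (hm : m ∈ χ.source) (hχ : DifferentiableAt ℝ χ m) (hχs : DifferentiableAt ℝ χ.symm (χ m)) :
    Function.Injective (fderiv ℝ χ m) := by
  have h := hχs.hasFDerivAt.comp m hχ.hasFDerivAt
  have e : (χ.symm ∘ χ) =ᶠ[𝓝 m] id := by
    filter_upwards [χ.open_source.mem_nhds hm] with z hz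
    exact χ.left_inv hz
  have k := (h.congr_of_eventuallyEq e.symm).unique (hasFDerivAt_id m)
  intro a b hab
  have ka := DFunLike.congr_fun k a
  have kb := DFunLike.congr_fun k b
  simp only [ContinuousLinearMap.comp_apply, ContinuousLinearMap.id_apply] at ka kb
  rw [← ka, ← kb, hab]

/-- The composition of a first integral with a submersion that carries `A` to a multiple of `B` at
each point. -/
theorem IsFirstIntegralOn.comp_submersion {m n : ℕ} {A : (Fin m → ℝ) → (Fin m → ℝ)}
    {B : (Fin n → ℝ) → (Fin n → ℝ)} {π : (Fin m → ℝ) → (Fin n → ℝ)} {I : (Fin n → ℝ) → ℝ}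
    {c : (Fin m → ℝ) → ℝ} {J : Set (Fin m → ℝ)} {Ω : Set (Fin n → ℝ)} (hΩ : IsOpen Ω)
    (hI : IsFirstIntegralOn B I Ω) (hπΩ : ∀ p ∈ J, π p ∈ Ω)
    (hπ : ∀ p ∈ J, ContDiffAt ℝ ∞ π p)
    (hsurj : ∀ p ∈ J, Function.Surjective (fderiv ℝ π p))
    (hA : ∀ p ∈ J, fderiv ℝ π p (A p) = c p • B (π p)) :
    IsFirstIntegralOn A (fun p => I (π p)) J where
  smooth p hp := ((hI.smooth.contDiffAt (hΩ.mem_nhds (hπΩ p hp))).comp p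
    (hπ p hp)).contDiffWithinAt
  nonconstant := by
    rintro U hUJ hU ⟨p, hp⟩ ⟨k, hk⟩
    -- A submersion is open, so constancy of I ∘ π on U would make I constant on an open set.
    have hopen : IsOpen (π '' U) := by
      refine isOpen_iff_mem_nhds.2 ?_
      rintro _ ⟨z, hz, rfl⟩
      have hs := ((hπ z (hUJ hz)).hasStrictFDerivAt (by simp)).map_nhds_eq_of_surj
        (LinearMap.range_eq_top.2 (hsurj z (hUJ hz)))
      rw [← hs]
      exact image_mem_map (hU.mem_nhds hz)
    refine hI.nonconstant (π '' U) ?_ hopen ⟨π p, p, hp, rfl⟩ ⟨k, ?_⟩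
    · rintro _ ⟨z, hz, rfl⟩
      exact hπΩ z (hUJ hz)
    · rintro _ ⟨z, hz, rfl⟩
      exact hk z hz
  invariant p hp := by
    have hd := (hI.smooth.contDiffAt (hΩ.mem_nhds (hπΩ p hp))).differentiableAt (by simp)
    have e := fderiv_comp p hd ((hπ p hp).differentiableAt (by simp))
    have i := hI.invariant (π p) (hπΩ p hp)
    simp only [Function.comp_def, along] at e i
    rw [along, e, ContinuousLinearMap.comp_apply, hA p hp, map_smul, i, smul_zero]

/-- The four vectors form a basis, so f ≠ 0 forces f(V₂) ≠ 0 and g ≠ 0 forces g(V₁) ≠ 0. Evaluating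
a relation at V₁ and V₂ isolates each coefficient. -/
theorem linearIndependent_pair_of_annihilates {E : Type*} [NormedAddCommGroup E] [NormedSpace ℝ E]
    [FiniteDimensional ℝ E] (hE : Module.finrank ℝ E = 4) {A V₁ V₂ V₃ : E} {f g : E →L[ℝ] ℝ}
    (hlin : LinearIndependent ℝ ![A, V₁, V₂, V₃]) (hf : f ≠ 0) (hg : g ≠ 0)
    (hfA : f A = 0) (hf₁ : f V₁ = 0) (hf₃ : f V₃ = 0)
    (hgA : g A = 0) (hg₂ : g V₂ = 0) (hg₃ : g V₃ = 0) : LinearIndependent ℝ ![f, g] := by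
  have hspan := hlin.span_eq_top_of_card_eq_finrank' (by simp [hE])
  have hzero : ∀ φ : E →L[ℝ] ℝ, φ A = 0 → φ V₁ = 0 → φ V₂ = 0 → φ V₃ = 0 → φ = 0 := by
    intro φ h0 h1 h2 h3
    have : (φ : E →ₗ[ℝ] ℝ) = 0 := by
      refine LinearMap.ext_on_range hspan fun i => ?_
      fin_cases i
      · exact h0
      · exact h1
      · exact h2
      · exact h3
    exact ContinuousLinearMap.coe_injective this
  have hf₂ : f V₂ ≠ 0 := fun h => hf (hzero f hfA hf₁ h hf₃)
  have hg₁ : g V₁ ≠ 0 := fun h => hg (hzero g hgA h hg₂ hg₃)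
  refine LinearIndependent.pair_iff.2 fun s t hst => ?_
  have e₁ := DFunLike.congr_fun hst V₁
  have e₂ := DFunLike.congr_fun hst V₂
  simp [hf₁, hg₂, hg₁, hf₂] at e₁ e₂
  exact ⟨e₂, e₁⟩

end SLTwoReduction

/-! ### The main theorem -/

theorem theorem2
    -- the third-order equation `u₃ = Φ(x, u, u₁, u₂)` on the open set `J`
    (J : Set (Fin 4 → ℝ)) (hJ : IsOpen J)
    (Φ : (Fin 4 → ℝ) → ℝ) (hΦ : ContDiffOn ℝ ∞ Φ J)
    -- the change of variables `χ(x, u) = (y, α)` on the open set `M = χ.source`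
    (χ : OpenPartialHomeomorph (Fin 2 → ℝ) (Fin 2 → ℝ))
    (hχ : ContDiffOn ℝ ∞ χ χ.source) (hχ_symm : ContDiffOn ℝ ∞ χ.symm χ.target)
    (hJM : ∀ p ∈ J, SLTwoReduction.base4 p ∈ χ.source)
    -- the Lie point symmetries, with the commutation relations of `sl(2, ℝ)`
    (v₁ v₂ v₃ : (Fin 2 → ℝ) → (Fin 2 → ℝ))
    (hv₁ : ContDiffOn ℝ ∞ v₁ χ.source) (hv₂ : ContDiffOn ℝ ∞ v₂ χ.source)
    (hv₃ : ContDiffOn ℝ ∞ v₃ χ.source)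
    (h13 : ∀ m ∈ χ.source, VectorField.lieBracket ℝ v₁ v₃ m = v₁ m)
    (h12 : ∀ m ∈ χ.source, VectorField.lieBracket ℝ v₁ v₂ m = (2 : ℝ) • v₃ m)
    (h32 : ∀ m ∈ χ.source, VectorField.lieBracket ℝ v₃ v₂ m = v₂ m)
    (hsymm₁ : SLTwoReduction.IsLiePointSymmetryOn Φ v₁ J)
    (hsymm₂ : SLTwoReduction.IsLiePointSymmetryOn Φ v₂ J)
    (hsymm₃ : SLTwoReduction.IsLiePointSymmetryOn Φ v₃ J)
    (hindep : ∀ p ∈ J, LinearIndependent ℝ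
      ![SLTwoReduction.odeField3 Φ p, SLTwoReduction.prolong2 v₁ p,
        SLTwoReduction.prolong2 v₂ p, SLTwoReduction.prolong2 v₃ p])
    -- `(y, α)` are canonical coordinates for `v₃`, and `y` can be used as independent variable
    (hcanon : ∀ m ∈ χ.source, fderiv ℝ χ m (v₃ m) = ![0, 1])
    (hDy : ∀ p ∈ J, SLTwoReduction.totalDeriv0 (fun m => χ m 0) (SLTwoReduction.jet1 p) ≠ 0)
    -- the reduced equation `w₂ = Ψ(y, w, w₁)` on the open set `Ω`
    (M₁ : Set (Fin 2 → ℝ)) (hM₁ : IsOpen M₁) (Ω : Set (Fin 3 → ℝ)) (hΩ : IsOpen Ω)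
    (hΩM₁ : ∀ q ∈ Ω, SLTwoReduction.base3 q ∈ M₁)
    (hJΩ : ∀ p ∈ J, SLTwoReduction.reduce2 χ p ∈ Ω)
    (Ψ : (Fin 3 → ℝ) → ℝ) (hΨ : ContDiffOn ℝ ∞ Ψ Ω)
    (hred : SLTwoReduction.IsReducedEquationOn Φ χ Ψ J)
    -- the pairs `(vbar₁, lam₁)` and `(vbar₂, lam₂)` inherited from `v₁` and `v₂`
    (ς₁ ς₂ : (Fin 2 → ℝ) → ℝ)
    (hς₁ : ContDiffOn ℝ ∞ ς₁ χ.source) (hς₂ : ContDiffOn ℝ ∞ ς₂ χ.source)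
    (hς₁0 : ∀ m ∈ χ.source, ς₁ m ≠ 0) (hς₂0 : ∀ m ∈ χ.source, ς₂ m ≠ 0)
    (hς₁v : ∀ m ∈ χ.source, SLTwoReduction.along v₃ ς₁ m = ς₁ m)
    (hς₂v : ∀ m ∈ χ.source, SLTwoReduction.along v₃ ς₂ m = -ς₂ m)
    (vbar₁ vbar₂ : (Fin 2 → ℝ) → (Fin 2 → ℝ))
    (hvbar₁ : ContDiffOn ℝ ∞ vbar₁ M₁) (hvbar₂ : ContDiffOn ℝ ∞ vbar₂ M₁)
    (hproj₁ : SLTwoReduction.IsProjectionOn χ ς₁ v₁ vbar₁ J)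
    (hproj₂ : SLTwoReduction.IsProjectionOn χ ς₂ v₂ vbar₂ J)
    (lam₁ lam₂ : (Fin 3 → ℝ) → ℝ)
    (hlam₁ : ContDiffOn ℝ ∞ lam₁ Ω) (hlam₂ : ContDiffOn ℝ ∞ lam₂ Ω)
    (hlamς₁ : SLTwoReduction.IsInheritedLambdaOn χ Ψ ς₁ lam₁ J)
    (hlamς₂ : SLTwoReduction.IsInheritedLambdaOn χ Ψ ς₂ lam₂ J)
    -- the two first integrals of the reduced equation
    (I₁ I₂ : (Fin 3 → ℝ) → ℝ)
    (hI₁ : SLTwoReduction.IsAssociatedFirstIntegralOn Ψ vbar₁ lam₁ I₁ Ω)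
    (hI₂ : SLTwoReduction.IsAssociatedFirstIntegralOn Ψ vbar₂ lam₂ I₂ Ω) :
    SLTwoReduction.IsFirstIntegralOn (SLTwoReduction.odeField3 Φ)
      (fun p => I₁ (SLTwoReduction.reduce2 χ p)) J ∧
    SLTwoReduction.IsFirstIntegralOn (SLTwoReduction.odeField3 Φ)
      (fun p => I₂ (SLTwoReduction.reduce2 χ p)) J ∧
    SLTwoReduction.FunctionallyIndependentOn
      (fun p => I₁ (SLTwoReduction.reduce2 χ p)) (fun p => I₂ (SLTwoReduction.reduce2 χ p)) J ∧
    (∀ p ∈ J, fderiv ℝ I₁ (SLTwoReduction.reduce2 χ p) ≠ 0 →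
      fderiv ℝ I₂ (SLTwoReduction.reduce2 χ p) ≠ 0 →
      LinearIndependent ℝ
        ![fderiv ℝ (fun p' => I₁ (SLTwoReduction.reduce2 χ p')) p,
          fderiv ℝ (fun p' => I₂ (SLTwoReduction.reduce2 χ p')) p]) ∧
    (∀ p ∈ J,
      SLTwoReduction.along (SLTwoReduction.prolong2 v₁)
        (fun p' => I₁ (SLTwoReduction.reduce2 χ p')) p = 0 ∧
      SLTwoReduction.along (SLTwoReduction.prolong2 v₃)
        (fun p' => I₁ (SLTwoReduction.reduce2 χ p')) p = 0 ∧
      SLTwoReduction.along (SLTwoReduction.prolong2 v₂)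
        (fun p' => I₂ (SLTwoReduction.reduce2 χ p')) p = 0 ∧
      SLTwoReduction.along (SLTwoReduction.prolong2 v₃)
        (fun p' => I₂ (SLTwoReduction.reduce2 χ p')) p = 0) := by
  have hχat : ∀ m ∈ χ.source, ContDiffAt ℝ ∞ χ m := fun m hm =>
    hχ.contDiffAt (χ.open_source.mem_nhds hm)
  have hχsat : ∀ m ∈ χ.source, ContDiffAt ℝ ∞ χ.symm (χ m) := fun m hm =>
    hχ_symm.contDiffAt (χ.open_target.mem_nhds (χ.map_source hm))
  have hπ : ∀ p ∈ J, ContDiffAt ℝ ∞ (SLTwoReduction.reduce2 χ) p := fun p hp =>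
    SLTwoReduction.contDiffAt_reduce2 (hχat _ (hJM p hp)) (hDy p hp)
  have hsurj : ∀ p ∈ J, Function.Surjective (fderiv ℝ (SLTwoReduction.reduce2 χ) p) := fun p hp =>
    SLTwoReduction.fderiv_reduce2_surjective (hχat _ (hJM p hp))
      (SLTwoReduction.fderiv_injective_of_mem_source (hJM p hp)
        ((hχat _ (hJM p hp)).differentiableAt (by simp))
        ((hχsat _ (hJM p hp)).differentiableAt (by simp))) (hDy p hp)
  have hA : ∀ p ∈ J, fderiv ℝ (SLTwoReduction.reduce2 χ) p (SLTwoReduction.odeField3 Φ p) =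
      SLTwoReduction.totalDeriv0 (fun m => χ m 0) (SLTwoReduction.jet1 p) •
        SLTwoReduction.odeField2 Ψ (SLTwoReduction.reduce2 χ p) := fun p hp =>
    SLTwoReduction.fderiv_reduce2_odeField3 (hχat _ (hJM p hp)) (hDy p hp) (hred p hp)
  have chain : ∀ (I : (Fin 3 → ℝ) → ℝ), ContDiffOn ℝ ∞ I Ω → ∀ p ∈ J,
      fderiv ℝ (fun p' => I (SLTwoReduction.reduce2 χ p')) p =
        (fderiv ℝ I (SLTwoReduction.reduce2 χ p)).comp
          (fderiv ℝ (SLTwoReduction.reduce2 χ) p) := fun I hI p hp =>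
    fderiv_comp p ((hI.contDiffAt (hΩ.mem_nhds (hJΩ p hp))).differentiableAt (by simp))
      ((hπ p hp).differentiableAt (by simp))
  have inv₃ : ∀ (I : (Fin 3 → ℝ) → ℝ), ContDiffOn ℝ ∞ I Ω → ∀ p ∈ J,
      SLTwoReduction.along (SLTwoReduction.prolong2 v₃)
        (fun p' => I (SLTwoReduction.reduce2 χ p')) p = 0 := by
    intro I hI p hp
    rw [SLTwoReduction.along, chain I hI p hp, ContinuousLinearMap.comp_apply,
      SLTwoReduction.fderiv_reduce2_prolong2_canonical χ.open_source (hJM p hp) hχ hv₃ hcanon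
        (hDy p hp), map_zero]
  have inv : ∀ (v vbar : (Fin 2 → ℝ) → (Fin 2 → ℝ)) (ς : (Fin 2 → ℝ) → ℝ)
      (lam I : (Fin 3 → ℝ) → ℝ), ContDiffOn ℝ ∞ v χ.source → ContDiffOn ℝ ∞ vbar M₁ →
      ContDiffOn ℝ ∞ ς χ.source → (∀ m ∈ χ.source, ς m ≠ 0) →
      SLTwoReduction.IsProjectionOn χ ς v vbar J →
      SLTwoReduction.IsInheritedLambdaOn χ Ψ ς lam J →
      SLTwoReduction.IsAssociatedFirstIntegralOn Ψ vbar lam I Ω →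
      ∀ p ∈ J, SLTwoReduction.along (SLTwoReduction.prolong2 v)
        (fun p' => I (SLTwoReduction.reduce2 χ p')) p = 0 := by
    intro v vbar ς lam I hv hvbar hς hς0 hproj hlam hI p hp
    have hm := hJM p hp
    have hsrc := χ.open_source.mem_nhds hm
    have hςat := hς.contDiffAt hsrc
    have hev : ∀ᶠ q in 𝓝 (SLTwoReduction.jet1 p),
        fderiv ℝ (SLTwoReduction.reduce1 χ) q
          (ς (SLTwoReduction.base3 q) • SLTwoReduction.prolong1 v q) =
            vbar (SLTwoReduction.reduce1 χ q) := by
      -- The projection identity is known at points `jet1 z` with z in J; these form a neighbourhood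
      -- because `jet1` is open.
      filter_upwards [SLTwoReduction.isOpenMap_jet1.image_mem_nhds (hJ.mem_nhds hp)]
      rintro _ ⟨z, hz, rfl⟩
      exact hproj z hz
    have hl := hlam p hp
    rw [SLTwoReduction.along_odeField3_comp_symm hm (hχat _ hm) (hχsat _ hm)
      (hςat.differentiableAt (by simp)) (hDy p hp)] at hl
    have key := SLTwoReduction.fderiv_reduce2_smul_prolong2
      (Filter.eventually_of_mem hsrc hχat) (hv.contDiffAt hsrc) (hDy p hp) hςat (hς0 _ hm)
      (hvbar.contDiffAt (hM₁.mem_nhds (hΩM₁ _ (hJΩ p hp)))) hev hl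
    have hY := hI.2 _ (hJΩ p hp)
    -- The invariance of I under its λ-prolongation now reads ς · v^{(2)}(I ∘ π) = 0, and ς ≠ 0.
    rw [SLTwoReduction.along, ← key, map_smul, map_smul, smul_eq_mul] at hY
    rw [SLTwoReduction.along, chain I hI.1.smooth p hp]
    exact (mul_eq_zero.1 hY).resolve_left (hς0 _ hm)
  have hF₁ : SLTwoReduction.IsFirstIntegralOn (SLTwoReduction.odeField3 Φ)
      (fun p => I₁ (SLTwoReduction.reduce2 χ p)) J :=
    hI₁.1.comp_submersion hΩ hJΩ hπ hsurj hA
  have hF₂ : SLTwoReduction.IsFirstIntegralOn (SLTwoReduction.odeField3 Φ)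
      (fun p => I₂ (SLTwoReduction.reduce2 χ p)) J :=
    hI₂.1.comp_submersion hΩ hJΩ hπ hsurj hA
  have inv₁ := inv v₁ vbar₁ ς₁ lam₁ I₁ hv₁ hvbar₁ hς₁ hς₁0 hproj₁ hlamς₁ hI₁
  have inv₂ := inv v₂ vbar₂ ς₂ lam₂ I₂ hv₂ hvbar₂ hς₂ hς₂0 hproj₂ hlamς₂ hI₂
  have hlin : ∀ p ∈ J, fderiv ℝ (fun p' => I₁ (SLTwoReduction.reduce2 χ p')) p ≠ 0 →
      fderiv ℝ (fun p' => I₂ (SLTwoReduction.reduce2 χ p')) p ≠ 0 →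
      LinearIndependent ℝ
        ![fderiv ℝ (fun p' => I₁ (SLTwoReduction.reduce2 χ p')) p,
          fderiv ℝ (fun p' => I₂ (SLTwoReduction.reduce2 χ p')) p] := fun p hp h₁ h₂ =>
    SLTwoReduction.linearIndependent_pair_of_annihilates (by simp) (hindep p hp) h₁ h₂
      (hF₁.invariant p hp) (inv₁ p hp) (inv₃ I₁ hI₁.1.smooth p hp)
      (hF₂.invariant p hp) (inv₂ p hp) (inv₃ I₂ hI₂.1.smooth p hp)
  have hne : ∀ (I : (Fin 3 → ℝ) → ℝ), ContDiffOn ℝ ∞ I Ω → ∀ p ∈ J,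
      fderiv ℝ I (SLTwoReduction.reduce2 χ p) ≠ 0 →
      fderiv ℝ (fun p' => I (SLTwoReduction.reduce2 χ p')) p ≠ 0 := by
    intro I hI p hp h0 h
    -- As dπ is onto, dI ∘ dπ = 0 would force dI = 0.
    refine h0 (ContinuousLinearMap.ext fun a => ?_)
    obtain ⟨b, rfl⟩ := hsurj p hp a
    rw [chain I hI p hp] at h
    exact DFunLike.congr_fun h b
  exact ⟨hF₁, hF₂, hF₁.functionallyIndependentOn hJ hF₂ hlin,
    fun p hp h₁ h₂ => hlin p hp (hne I₁ hI₁.1.smooth p hp h₁) (hne I₂ hI₂.1.smooth p hp h₂),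
    fun p hp => ⟨inv₁ p hp, inv₃ I₁ hI₁.1.smooth p hp, inv₂ p hp, inv₃ I₂ hI₂.1.smooth p hp⟩⟩
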